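/- A binary sequence of length $t>1$ is an element $A=(a_0,\dots,a_{t-1})$ of $\{-1,1\}^t$. Its aperiodic autocorrelations are $c_u=\sum_{j=0}^{t-u-1}a_ja_{j+u}$, and its merit factor is $F(A)=t^2\big/\bigl(2\sum_{u=1}^{t-1}c_u^2\bigr)$. Given a sequence $A=(a_0,\dots,a_{n-1})\in\{-1,1\}^n$, extend it to all $j\in\mathbb Z$ by $a_{j+n}=a_j$. For integers $r$ and $t\ge 0$ put $$A^{r,t}=(a_r,a_{r+1},\dots,a_{r+t-1}),$$ and let $N(A)$ and $P(A)$ be the sequences of length $4n$ with entries $$N(A)_j=(-1)^{j(j-1)/2}a_j,\qquad P(A)_j=(-1)^{j(j-1)^2/2}a_j\qquad(0\le j<4n).$$ (When $N(A)^{r,t}$ and $P(A)^{r,t}$ are formed, $N(A)$ and $P(A)$ are extended with period $4n$.) For $d\ge 1$, $n=2^d-1$ and a primitive element $\theta$ of $\mathbb F_{2^d}$ (a generator of $\mathbb F_{2^d}^*$), the Galois sequence of length $n$ with respect to $\theta$ is $Y_{n,\theta}=(\psi(\theta^0),\psi(\theta^1),\dots,\psi(\theta^{n-1}))$, where $\psi(y)=(-1)^{\mathrm{Tr}(y)}$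 and $\mathrm{Tr}:\mathbb F_{2^d}\to\mathbb F_2$ is the absolute trace. Define $h$ on the positive reals by $$\frac1{h(T)}=1-\frac{2T}{3}+4\sum_{m=1}^{\infty}\max\Bigl(0,1-\frac mT\Bigr)^2 ,$$ where the sum has only finitely many nonzero terms. **Theorem.** For each $n=2^d-1$ choose an arbitrary integer $r$, an arbitrary integer $t\ge 0$ and an arbitrary primitive $\theta\in\mathbb F_{2^d}$ (all may depend on $n$), and let $T>0$ be real. Then, as $n\to\infty$: 1. if $t/n\to T$, then $F(Y_{n,\theta}^{r,t})\to h(T)$; 2. if $t/(2n)\to T$, then $F(N(Y_{n,\theta})^{r,t})\to h(T)$; 3. if $t/(4n)\to T$, then $F(P(Y_{n,\theta})^{r,t})\to h(T)$. Moreover, the right-hand side of the formula for $1/h(T)$ is positive for every $T>0$ (so $h$ is well defined and positive), and $h$ has a unique global maximum on $(0,\infty)$. It is attained at $T_b=1.115749\dots$, the middle one of the three real roots of $x^3-12x+12$, and its value is $F_b=3.342065\dots$, the largest real root of $7x^3-33x^2+33x-3$. -/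

import Mathlib

open Filter Topology

namespace MeritFactor

/-- Aperiodic autocorrelation at shift `u`: `c_u = ∑_{j = 0}^{t - u - 1} a_j a_{j + u}`. -/
def autocorrelation {t : ℕ} (a : Fin t → ℤ) (u : ℕ) : ℤ :=
  ∑ j : Fin t, if h : (j : ℕ) + u < t then a j * a ⟨j + u, h⟩ else 0

/-- Golay's merit factor `t² / (2 ∑_{u = 1}^{t - 1} c_u²)` of a sequence of length `t`.
The denominator is positive for every `±1` sequence of length `t ≥ 2`. -/
noncomputable def meritFactor {t : ℕ} (a : Fin t → ℤ) : ℝ :=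
  (t : ℝ) ^ 2 / (2 * ∑ u ∈ Finset.Ico 1 t, (autocorrelation a u : ℝ) ^ 2)

/-- The extension of `(a_0, …, a_{n-1})` to all integer indices with `a_{j + n} = a_j`
(the value for the empty sequence is irrelevant). -/
def periodicExtension {n : ℕ} (a : Fin n → ℤ) (j : ℤ) : ℤ :=
  if h : 0 < n then a ⟨(j % (n : ℤ)).toNat, by
    have h1 := Int.emod_nonneg j (show (n : ℤ) ≠ 0 by omega)
    have h2 := Int.emod_lt_of_pos j (show (0 : ℤ) < n by omega)
    omega⟩ else 0

/-- The sequence `a^{r,t} = (a_r, a_{r+1}, …, a_{r+t-1})`: rotation by `r`, followed by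
truncation or periodic appending to length `t`. -/
def rotateTo {n : ℕ} (a : Fin n → ℤ) (r : ℤ) (t : ℕ) : Fin t → ℤ :=
  fun j => periodicExtension a ((j : ℤ) + r)

/-- The negaperiodic construction `N(a)`, of length `4n`, with signs `+ + - -` repeated. -/
def negaperiodic {n : ℕ} (a : Fin n → ℤ) : Fin (4 * n) → ℤ :=
  fun j => (-1) ^ ((j : ℕ) * ((j : ℕ) - 1) / 2) * periodicExtension a (j : ℤ)

/-- The periodic construction `P(a)`, of length `4n`, with signs `+ + - +` repeated. -/
def periodic {n : ℕ} (a : Fin n → ℤ) : Fin (4 * n) → ℤ :=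
  fun j => (-1) ^ ((j : ℕ) * ((j : ℕ) - 1) ^ 2 / 2) * periodicExtension a (j : ℤ)

/-- The canonical additive character `ψ(y) = (-1)^{Tr(y)}` of the field with `2 ^ d` elements,
where `Tr` is the absolute trace. -/
noncomputable def canonicalCharacter (d : ℕ) (y : GaloisField 2 d) : ℤ :=
  (-1) ^ (Algebra.trace (ZMod 2) (GaloisField 2 d) y).val

/-- `θ` is a primitive element of the field: it generates the multiplicative group. -/
def IsPrimitiveElement {d : ℕ} (θ : (GaloisField 2 d)ˣ) : Prop :=
  Subgroup.zpowers θ = ⊤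

/-- The Galois sequence `(ψ(θ^0), ψ(θ^1), …, ψ(θ^{n-1}))` of length `n = 2 ^ d - 1`. -/
noncomputable def galoisSequence (d : ℕ) (θ : (GaloisField 2 d)ˣ) : Fin (2 ^ d - 1) → ℤ :=
  fun j => canonicalCharacter d ((θ : GaloisField 2 d) ^ (j : ℕ))

/-- The reciprocal of `h`: `1 - 2T/3 + 4 ∑_{m ≥ 1} max(0, 1 - m/T)²`. For `T > 0` the sum has
only finitely many nonzero terms. -/
noncomputable def hInv (T : ℝ) : ℝ :=
  1 - 2 * T / 3 + 4 * ∑' m : ℕ+, (max 0 (1 - (m : ℝ) / T)) ^ 2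

/-- The limit function `h`. -/
noncomputable def h (T : ℝ) : ℝ := 1 / hInv T

end MeritFactor

namespace MeritFactor

open Finset

/-! The sum of all squared autocorrelations, over positive and negative shifts, is a sum over
parallelograms `j, j+u, j+e, j+u+e` of products of four entries. Place the window in `ℤ/N` with `N =
nL`, `L` fixed, `4 ∣ N` and `2t ≤ N`, so that cyclic and aperiodic correlations agree. Each entry is
then `F j * a j`, with `a` the Galois sequence and `F` a sign pattern `s` of period 4 cut off at
length `t`.

Since `ψ(x)ψ(xθ^u) = ψ(x(1+θ^u))`, the product of `a` over a parallelogram is 1 if `n` divides `u`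
or `e`. Otherwise it is a single shifted value of `a`, whose mean is `-1/n`. The error made by
replacing this value by its mean is controlled by Fourier analysis in `j, u, e`: each coefficient
factors into a Gauss-type sum and two Jacobi-type sums, all `O(√N)`
(`ShiftAdd.norm_char_parallelogramDefect_le`). As `F` is a combination of characters with `ℓ¹` norm
`O(log N)`, the total error is `O(N^{3/2} log⁴ N) = o(t²)` (`ShiftAdd.abs_energy_sub_le`).

What remains involves only `s`: twice the energy of `s` at multiples of `n`, minus `1/n` times its
full energy. The autocorrelations of `s` are `±(t-u)` at multiples of `p` and bounded elsewhere,
with `p = 1, 2, 4` for the three constructions, and `n` is odd. With `t/(pn) → T`, these energies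
divided by `t²` give the series and the term `2T/3` of `hInv` (`tendsto_corrEnergy_div_sq`).

To minimise `hInv`, the first term of the series suffices on `[1, 4]`, where the difference from the
critical value has an explicit double root at `b` (`limit_sub_min_eq`). Outside this interval `hInv`
is at least `1/3`, which already exceeds that value. -/

/-- A `±1`-valued function on a finite abelian group, invariant under the subgroup `H`, with the
shift-and-add property of an m-sequence outside `H`. -/
structure ShiftAdd {G : Type*} [AddCommGroup G] [Fintype G] (H : AddSubgroup G) (a : G → ℝ) :
    Prop where
  mul_self : ∀ j, a j * a j = 1
  invariant : ∀ u ∈ H, ∀ j, a (j + u) = a j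
  exists_shift : ∀ u ∉ H, ∃ v, ∀ j, a j * a (j + u) = a (j + v)
  sum_eq : ∑ j, a j = -(Nat.card H : ℝ)

/-! ### Gauss- and Jacobi-type sums of a shift-and-add function. -/

section CharacterSums

variable {G : Type*} [AddCommGroup G] [Fintype G]

/-- The Fourier coefficient of `a` at the character `χ`. -/
noncomputable def charSum (a : G → ℝ) (χ : AddChar G ℂ) : ℂ := ∑ j, χ j * (a j : ℂ)

lemma sum_char_mul_correlation (a : G → ℝ) (χ χ₁ : AddChar G ℂ) :
    ∑ u, ∑ j, χ u * (χ₁ j * (a j * a (j + u) : ℂ)) = charSum a (χ₁ - χ) * charSum a χ := by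
  unfold charSum
  rw [sum_comm, sum_mul_sum]
  refine sum_congr rfl fun j _ => ?_
  refine Fintype.sum_equiv (Equiv.addLeft j) _ _ fun u => ?_
  have h : χ (-j) * χ j = 1 := by rw [← AddChar.map_add_eq_mul]; simp
  simp only [Equiv.coe_addLeft, AddChar.sub_apply, AddChar.map_add_eq_mul]
  linear_combination (-(χ u * χ₁ j * a j * a (j + u))) * h

lemma sum_char_shift (a : G → ℝ) (χ : AddChar G ℂ) (v : G) :
    ∑ j, χ j * (a (j + v) : ℂ) = χ (-v) * charSum a χ := by
  unfold charSum
  rw [mul_sum]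
  refine Fintype.sum_equiv (Equiv.addRight v) _ _ fun j => ?_
  simp only [Equiv.coe_addRight, ← mul_assoc, ← AddChar.map_add_eq_mul]
  congr 2
  abel

lemma star_charSum (a : G → ℝ) (χ : AddChar G ℂ) :
    (starRingEnd ℂ) (charSum a χ) = charSum a (-χ) := by
  simp [charSum, map_sum, AddChar.map_neg_eq_conj]

variable {H : AddSubgroup G} {a : G → ℝ}

open Classical in
lemma ShiftAdd.sum_correlation (ha : ShiftAdd H a) (u : G) :
    ∑ j, (a j * a (j + u) : ℂ) = if u ∈ H then (Fintype.card G : ℂ) else -(Nat.card H : ℂ) := by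
  split_ifs with hu
  · have : ∀ j, (a j * a (j + u) : ℂ) = 1 := fun j => by
      rw [ha.invariant u hu]; exact_mod_cast ha.mul_self j
    simp [this]
  · obtain ⟨v, hv⟩ := ha.exists_shift u hu
    have h1 : ∑ j, a (j + v) = ∑ j, a j := Fintype.sum_equiv (Equiv.addRight v) _ _ fun _ => rfl
    have h2 : ∑ j, a j * a (j + u) = -(Nat.card H : ℝ) := by
      rw [sum_congr rfl fun j _ => hv j, h1, ha.sum_eq]
    exact_mod_cast h2

open Classical in
lemma sum_subgroup_char (H : AddSubgroup G) (χ : AddChar G ℂ) :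
    (∑ u, if u ∈ H then χ u else 0) = if (∀ u ∈ H, χ u = 1) then (Nat.card H : ℂ) else 0 := by
  have h0 : (∑ u, if u ∈ H then χ u else 0) = ∑ u : H, χ u := by
    rw [← sum_filter]
    exact (sum_subtype _ (by simp) _)
  rw [h0]
  split_ifs with h
  · simp [h _ (Subtype.property _)]
  · have := AddChar.sum_eq_zero_iff_ne_zero (ψ := χ.compAddMonoidHom H.subtype)
    simp only [AddChar.compAddMonoidHom_apply, AddSubgroup.coe_subtype] at this
    rw [this, AddChar.ne_zero_iff]
    push Not at h
    obtain ⟨u, hu, hu'⟩ := h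
    exact ⟨⟨u, hu⟩, by simpa using hu'⟩

-- This is the Fourier transform of the two-valued autocorrelation: `|G|` on `H` and `-|H|` off it.
open Classical in
lemma ShiftAdd.norm_charSum_sq (ha : ShiftAdd H a) (χ : AddChar G ℂ) :
    ‖charSum a χ‖ ^ 2 = (if ∀ u ∈ H, χ u = 1 then
        ((Fintype.card G : ℝ) + Nat.card H) * Nat.card H else 0)
      - (if χ = 0 then (Nat.card H : ℝ) * Fintype.card G else 0) := by
  have h1 := sum_char_mul_correlation a χ 0
  rw [zero_sub, ← star_charSum, mul_comm _ (charSum a χ), Complex.mul_conj,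
    Complex.normSq_eq_norm_sq] at h1
  simp only [AddChar.zero_apply, one_mul, ← mul_sum, ha.sum_correlation] at h1
  have h2 : ∀ u, χ u * (if u ∈ H then (Fintype.card G : ℂ) else -(Nat.card H : ℂ)) =
      ((Fintype.card G : ℂ) + Nat.card H) * (if u ∈ H then χ u else 0) - Nat.card H * χ u := by
    intro u; split_ifs <;> ring
  rw [sum_congr rfl fun u _ => h2 u, sum_sub_distrib, ← mul_sum, ← mul_sum, sum_subgroup_char,
    AddChar.sum_eq_ite] at h1
  have : ((‖charSum a χ‖ ^ 2 : ℝ) : ℂ) = (((if ∀ u ∈ H, χ u = 1 then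
        ((Fintype.card G : ℝ) + Nat.card H) * Nat.card H else 0)
      - (if χ = 0 then (Nat.card H : ℝ) * Fintype.card G else 0) : ℝ) : ℂ) := by
    rw [← h1]; push_cast [apply_ite]; split_ifs <;> simp
  exact_mod_cast this

lemma ShiftAdd.norm_charSum_sq_le (ha : ShiftAdd H a) (χ : AddChar G ℂ) :
    ‖charSum a χ‖ ^ 2 ≤ ((Fintype.card G : ℝ) + Nat.card H) * Nat.card H := by
  classical
  rw [ha.norm_charSum_sq]
  have h1 : (0 : ℝ) ≤ (Nat.card H : ℝ) * Fintype.card G := by positivity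
  have h2 : (0 : ℝ) ≤ ((Fintype.card G : ℝ) + Nat.card H) * Nat.card H := by positivity
  split_ifs <;> linarith

lemma ShiftAdd.norm_charSum_sq_eq (ha : ShiftAdd H a) {χ : AddChar G ℂ} (hχ : χ ≠ 0)
    (h0 : charSum a χ ≠ 0) :
    ‖charSum a χ‖ ^ 2 = ((Fintype.card G : ℝ) + Nat.card H) * Nat.card H := by
  classical
  have h := ha.norm_charSum_sq χ
  have h1 : 0 < ‖charSum a χ‖ ^ 2 := by positivity
  rw [if_neg hχ, sub_zero] at h
  split_ifs at h with h2
  · exact h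
  · exact absurd h h1.ne'

/-- The fourfold product of `a` along a parallelogram minus its expected value; it vanishes on
degenerate parallelograms. -/
noncomputable def parallelogramDefect (H : AddSubgroup G) (a : G → ℝ) (j u e : G) : ℝ :=
  open Classical in
  if u ∈ H ∨ e ∈ H then 0 else
    a j * a (j + u) * (a (j + e) * a (j + u + e)) + (Nat.card H : ℝ) / Fintype.card G

lemma ShiftAdd.norm_char_parallelogramDefect_le (ha : ShiftAdd H a) (χ₁ χ₂ χ₃ : AddChar G ℂ) :
    ‖∑ u, ∑ e, ∑ j, χ₁ j * χ₂ u * χ₃ e * (parallelogramDefect H a j u e : ℂ)‖ ≤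
      √(((Fintype.card G : ℝ) + Nat.card H) * Nat.card H) ^ 3 := by
  classical
  set Q : ℝ := ((Fintype.card G : ℝ) + Nat.card H) * Nat.card H with hQ
  have hQ0 : 0 ≤ Q := by positivity
  have hG : (0 : ℝ) < Fintype.card G := by exact_mod_cast Fintype.card_pos
  choose! v hv using ha.exists_shift
  set w : ℂ := (Nat.card H : ℂ) / Fintype.card G with hw
  have hT : ∑ u, ∑ e, ∑ j, χ₁ j * χ₂ u * χ₃ e * (parallelogramDefect H a j u e : ℂ) =
      ∑ u, ∑ e, if u ∈ H ∨ e ∈ H then 0 else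
        χ₂ u * χ₃ e * (χ₁ (-v u - v e) * charSum a χ₁ + (∑ j, χ₁ j) * w) := by
    refine sum_congr rfl fun u _ => sum_congr rfl fun e _ => ?_
    split_ifs with hue
    · simp [parallelogramDefect, hue]
    · have hu : u ∉ H := fun h => hue (Or.inl h)
      have he : e ∉ H := fun h => hue (Or.inr h)
      have h1 : ∀ j, parallelogramDefect H a j u e =
          a (j + (v u + v e)) + (Nat.card H : ℝ) / Fintype.card G := by
        intro j
        rw [parallelogramDefect, if_neg hue, hv u hu, add_right_comm j u e, hv u hu,
          add_right_comm j e, hv e he, add_assoc]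
      rw [show -v u - v e = -(v u + v e) by abel, ← sum_char_shift, sum_mul, ← sum_add_distrib,
        mul_sum]
      refine sum_congr rfl fun j _ => ?_
      rw [h1]
      push_cast
      ring
  rw [hT]
  -- The constant in `parallelogramDefect` is chosen to give mean zero in `j`, so the trivial
  -- character contributes nothing.
  by_cases hχ : χ₁ = 0
  · have h0 : charSum a (0 : AddChar G ℂ) + Fintype.card G * w = 0 := by
      have h1 : charSum a (0 : AddChar G ℂ) = -(Nat.card H : ℂ) := by
        have := ha.sum_eq
        simp only [charSum, AddChar.zero_apply, one_mul]
        exact_mod_cast this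
      have : (Fintype.card G : ℂ) ≠ 0 := by exact_mod_cast hG.ne'
      rw [h1, hw]
      field_simp
      simp
    subst hχ
    simp only [AddChar.zero_apply, one_mul, sum_const, card_univ, nsmul_eq_mul, mul_one, h0,
      mul_zero, ite_self, norm_zero]
    positivity
  · rw [AddChar.sum_eq_ite, if_neg hχ]
    -- A Jacobi-type sum. The excluded pairs are excluded separately in `u` and in `e`, so the
    -- double sum factors.
    set J : AddChar G ℂ → ℂ := fun χ => ∑ u, if u ∈ H then 0 else χ u * χ₁ (-v u) with hJ
    have hfac : (∑ u, ∑ e, if u ∈ H ∨ e ∈ H then (0 : ℂ) else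
        χ₂ u * χ₃ e * (χ₁ (-v u - v e) * charSum a χ₁ + 0 * w)) =
        charSum a χ₁ * (J χ₂ * J χ₃) := by
      simp only [hJ]
      rw [sum_mul_sum, mul_sum]
      refine sum_congr rfl fun u _ => ?_
      rw [mul_sum]
      refine sum_congr rfl fun e _ => ?_
      by_cases hu : u ∈ H <;> by_cases he : e ∈ H <;> simp [hu, he]
      rw [sub_eq_add_neg, AddChar.map_add_eq_mul]
      ring
    rw [hfac]
    by_cases h0 : charSum a χ₁ = 0
    · rw [h0]; simp
    have hn := ha.norm_charSum_sq_eq hχ h0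
    have hn' : ‖charSum a χ₁‖ = √Q := by
      rw [← Real.sqrt_sq (norm_nonneg (charSum a χ₁)), hn]
    have hQp : 0 < √Q := by rw [← hn']; exact norm_pos_iff.2 h0
    have hle : ∀ χ, ‖charSum a χ‖ ≤ √Q := fun χ =>
      Real.le_sqrt_of_sq_le (ha.norm_charSum_sq_le χ)
    have hJle : ∀ χ, ‖J χ‖ ≤ √Q := by
      intro χ
      -- The analogue of expressing a Jacobi sum by Gauss sums. Shifts `u ∈ H`, absent from `J`,
      -- contribute `∑ χ₁ = 0`. Dividing by `charSum a χ₁`, of norm exactly `√Q`, bounds `J` by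
      -- `√Q`.
      have h1 : charSum a χ₁ * J χ = charSum a (χ₁ - χ) * charSum a χ := by
        rw [← sum_char_mul_correlation, mul_sum]
        refine sum_congr rfl fun u _ => ?_
        split_ifs with hu
        · have : ∀ j, (a j * a (j + u) : ℂ) = 1 := fun j => by
            rw [ha.invariant u hu]; exact_mod_cast ha.mul_self j
          simp only [this, mul_one, ← mul_sum]
          rw [AddChar.sum_eq_ite, if_neg hχ, mul_zero, mul_zero]
        · have h2 : ∀ j, (a j * a (j + u) : ℂ) = a (j + v u) := fun j => by
            exact_mod_cast hv u hu j
          simp only [h2, ← mul_sum, sum_char_shift]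
          ring
      have h2 : √Q * ‖J χ‖ ≤ √Q * √Q := by
        rw [← hn', ← norm_mul, h1, norm_mul, hn']
        exact mul_le_mul (hle _) (hle _) (norm_nonneg _) (Real.sqrt_nonneg _)
      exact le_of_mul_le_mul_left h2 hQp
    rw [norm_mul, norm_mul, hn', pow_succ', sq]
    gcongr
    · exact hJle _
    · exact hJle _

end CharacterSums

/-! ### Functions with a bounded `ℓ¹` norm of character coefficients. -/

section CharacterExpansion

variable {G : Type*} [AddCommGroup G]

/-- `f` is a combination of characters whose coefficients have `ℓ¹` norm at most `B`. -/
def HasCharBound (f : G → ℂ) (B : ℝ) : Prop :=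
  ∃ (ι : Type) (_ : Fintype ι) (c : ι → ℂ) (χ : ι → AddChar G ℂ),
    (∀ j, f j = ∑ i, c i * χ i j) ∧ ∑ i, ‖c i‖ ≤ B

lemma HasCharBound.mono {f : G → ℂ} {B B' : ℝ} (hf : HasCharBound f B) (h : B ≤ B') :
    HasCharBound f B' := by
  obtain ⟨ι, hι, c, χ, h1, h2⟩ := hf
  exact ⟨ι, hι, c, χ, h1, h2.trans h⟩

lemma HasCharBound.nonneg {f : G → ℂ} {B : ℝ} (hf : HasCharBound f B) : 0 ≤ B := by
  obtain ⟨ι, hι, c, χ, h1, h2⟩ := hf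
  exact (sum_nonneg fun _ _ => norm_nonneg _).trans h2

lemma HasCharBound.mul {f g : G → ℂ} {B C : ℝ} (hf : HasCharBound f B) (hg : HasCharBound g C) :
    HasCharBound (fun j => f j * g j) (B * C) := by
  have hB := hf.nonneg
  obtain ⟨ι, hι, c, χ, h1, h2⟩ := hf
  obtain ⟨κ, hκ, d, φ, h3, h4⟩ := hg
  refine ⟨ι × κ, inferInstance, fun x => c x.1 * d x.2, fun x => χ x.1 + φ x.2, fun j => ?_, ?_⟩
  · simp only [h1, h3]
    rw [sum_mul_sum, Fintype.sum_prod_type]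
    refine sum_congr rfl fun i _ => sum_congr rfl fun k _ => ?_
    rw [AddChar.add_apply]
    ring
  · simp only [norm_mul]
    rw [Fintype.sum_prod_type]
    simp only
    rw [← sum_mul_sum]
    exact mul_le_mul h2 h4 (sum_nonneg fun _ _ => norm_nonneg _) hB

lemma HasCharBound.norm_sum_comp_mul_le {f : G → ℂ} {B M : ℝ} (hf : HasCharBound f B)
    {X : Type*} [Fintype X] (p : X → G) (k : X → ℂ)
    (hk : ∀ χ : AddChar G ℂ, ‖∑ x, χ (p x) * k x‖ ≤ M) : ‖∑ x, f (p x) * k x‖ ≤ B * M := by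
  have hM : 0 ≤ M := (norm_nonneg _).trans (hk 0)
  obtain ⟨ι, hι, c, χ, h1, h2⟩ := hf
  have h : ∑ x, f (p x) * k x = ∑ i, c i * ∑ x, χ i (p x) * k x := by
    simp only [mul_sum]
    rw [sum_comm]
    refine sum_congr rfl fun x _ => ?_
    rw [h1, sum_mul]
    exact sum_congr rfl fun i _ => by ring
  rw [h]
  calc ‖∑ i, c i * ∑ x, χ i (p x) * k x‖ ≤ ∑ i, ‖c i‖ * M := by
        refine (norm_sum_le _ _).trans (sum_le_sum fun i _ => ?_)
        rw [norm_mul]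
        exact mul_le_mul_of_nonneg_left (hk _) (norm_nonneg _)
    _ ≤ B * M := by rw [← sum_mul]; exact mul_le_mul_of_nonneg_right h2 hM

/-- The four factors are expanded one at a time, each at the cost of a factor `B`. A product of
characters at the vertices is again a product of characters in `j`, `u` and `e`. -/
lemma HasCharBound.norm_parallelogram_sum_le [Fintype G] {f : G → ℂ} {B M : ℝ}
    (hf : HasCharBound f B) (K : G → G → G → ℂ)
    (hK : ∀ χ₁ χ₂ χ₃ : AddChar G ℂ,
      ‖∑ u, ∑ e, ∑ j, χ₁ j * χ₂ u * χ₃ e * K j u e‖ ≤ M) :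
    ‖∑ u, ∑ e, ∑ j, f j * f (j + u) * (f (j + e) * f (j + u + e)) * K j u e‖ ≤ B ^ 4 * M := by
  have h1 : ∀ F : G → G → G → ℂ, ∑ u, ∑ e, ∑ j, F j u e =
      ∑ x : G × G × G, F x.2.2 x.1 x.2.1 := fun F => by
    simp only [Fintype.sum_prod_type]
  have hB : B ^ 4 * M = B * (B * (B * (B * M))) := by ring
  rw [h1 fun j u e => f j * f (j + u) * (f (j + e) * f (j + u + e)) * K j u e, hB]
  have e1 : ∀ x : G × G × G, f x.2.2 * f (x.2.2 + x.1) * (f (x.2.2 + x.2.1) *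
      f (x.2.2 + x.1 + x.2.1)) * K x.2.2 x.1 x.2.1 = f x.2.2 * (f (x.2.2 + x.1) *
      (f (x.2.2 + x.2.1) * (f (x.2.2 + x.1 + x.2.1) * K x.2.2 x.1 x.2.1))) := fun x => by ring
  simp only [e1]
  refine hf.norm_sum_comp_mul_le (fun x : G × G × G => x.2.2) _ fun χ₁ => ?_
  have e2 : ∀ a b c d : ℂ, a * (b * (c * d)) = c * (a * (b * d)) := fun a b c d => by ring
  have e3 : ∀ a b c d e : ℂ, a * (b * (c * (d * e))) = d * (a * (b * (c * e))) :=
    fun a b c d e => by ring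
  refine le_of_eq_of_le (congrArg norm (sum_congr rfl fun x _ => mul_left_comm _ _ _))
    (hf.norm_sum_comp_mul_le (fun x : G × G × G => x.2.2 + x.1) _ fun χ₂ => ?_)
  refine le_of_eq_of_le (congrArg norm (sum_congr rfl fun x _ => e2 _ _ _ _))
    (hf.norm_sum_comp_mul_le (fun x : G × G × G => x.2.2 + x.2.1) _ fun χ₃ => ?_)
  refine le_of_eq_of_le (congrArg norm (sum_congr rfl fun x _ => e3 _ _ _ _ _))
    (hf.norm_sum_comp_mul_le (fun x : G × G × G => x.2.2 + x.1 + x.2.1) _ fun χ₄ => ?_)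
  -- All four vertices contain `j`; only those of `χ₂, χ₄` contain `u`, and only those of `χ₃, χ₄`
  -- contain `e`.
  have := hK (χ₁ + χ₂ + χ₃ + χ₄) (χ₂ + χ₄) (χ₃ + χ₄)
  rw [h1 fun j u e => (χ₁ + χ₂ + χ₃ + χ₄) j * (χ₂ + χ₄) u * (χ₃ + χ₄) e * K j u e] at this
  refine le_of_eq_of_le ?_ this
  congr 1
  refine sum_congr rfl fun x _ => ?_
  simp only [AddChar.add_apply, AddChar.map_add_eq_mul]
  ring

end CharacterExpansion

/-! ### Character expansion of an interval in `ℤ/N`. -/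

section Windows

lemma sum_zmod_val {α : Type*} [AddCommMonoid α] (N : ℕ) [NeZero N] (g : ℕ → α) :
    ∑ z : ZMod N, g z.val = ∑ k ∈ range N, g k := by
  refine sum_nbij' ZMod.val (fun k => (k : ZMod N)) ?_ ?_ ?_ ?_ ?_
  · intro z _; simpa using ZMod.val_lt z
  · simp
  · intro z _; simp
  · intro k hk; exact ZMod.val_cast_of_lt (by simpa using hk)
  · simp

lemma hasCharBound_dft {N : ℕ} [NeZero N] (f : ZMod N → ℂ) :
    HasCharBound f (∑ k : ZMod N, ‖(N : ℂ)⁻¹ * ZMod.dft f k‖) := by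
  refine ⟨ZMod N, inferInstance, fun k => (N : ℂ)⁻¹ * ZMod.dft f k,
    fun k => (ZMod.stdAddChar (N := N)).mulShift k, fun j => ?_, le_rfl⟩
  have h := ZMod.invDFT_apply (ZMod.dft f) j
  rw [LinearEquiv.symm_apply_apply] at h
  rw [h, smul_eq_mul, mul_sum]
  refine sum_congr rfl fun k _ => ?_
  rw [AddChar.mulShift_apply, smul_eq_mul]
  ring

lemma HasCharBound.comp_hom {G G' : Type*} [AddCommGroup G] [AddCommGroup G'] {f : G' → ℂ} {B : ℝ}
    (hf : HasCharBound f B) (φ : G →+ G') : HasCharBound (fun j => f (φ j)) B := by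
  obtain ⟨ι, hι, c, χ, h1, h2⟩ := hf
  exact ⟨ι, hι, c, fun i => (χ i).compAddMonoidHom φ, fun j => by simp [h1], h2⟩

/-- A crude bound, sufficient for the sign patterns because they live on `ℤ/4`. -/
lemma hasCharBound_of_norm_le_one {N : ℕ} [NeZero N] (f : ZMod N → ℂ) (hf : ∀ z, ‖f z‖ ≤ 1) :
    HasCharBound f N := by
  refine (hasCharBound_dft f).mono ?_
  have hN : (0 : ℝ) < N := by exact_mod_cast NeZero.pos N
  have h : ∀ k : ZMod N, ‖(N : ℂ)⁻¹ * ZMod.dft f k‖ ≤ 1 := by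
    intro k
    rw [norm_mul, norm_inv, Complex.norm_natCast, inv_mul_le_iff₀ hN, mul_one, ZMod.dft_apply]
    refine (norm_sum_le _ _).trans ?_
    calc ∑ j : ZMod N, ‖ZMod.stdAddChar (-(j * k)) • f j‖ ≤ ∑ j : ZMod N, (1 : ℝ) := by
          refine sum_le_sum fun j _ => ?_
          rw [norm_smul, AddChar.norm_apply, one_mul]
          exact hf j
      _ = N := by simp [ZMod.card]
  refine (sum_le_sum fun k _ => h k).trans ?_
  simp [ZMod.card]

lemma norm_geom_sum_mul_le {ω : ℂ} (hω : ‖ω‖ = 1) (t : ℕ) :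
    ‖∑ j ∈ range t, ω ^ j‖ * ‖ω - 1‖ ≤ 2 := by
  rw [← norm_mul, geom_sum_mul]
  refine (norm_sub_le _ _).trans ?_
  rw [norm_pow, hω]
  norm_num

/-- Jordan's inequality on the first half of the interval, reflected by `sin (π - x) = sin x` on the
second. -/
lemma inv_sin_le {N k : ℕ} (hk : 0 < k) (hkN : k < N) :
    (Real.sin (Real.pi * k / N))⁻¹ ≤ (N : ℝ) / 2 * ((k : ℝ)⁻¹ + ((N : ℝ) - k)⁻¹) := by
  have hN : (0 : ℝ) < N := by exact_mod_cast hk.trans hkN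
  have hk' : (0 : ℝ) < k := by exact_mod_cast hk
  have hkN' : (k : ℝ) < N := by exact_mod_cast hkN
  have hpi := Real.pi_pos
  have key : ∀ x : ℝ, 0 < x → x ≤ N / 2 →
      (Real.sin (Real.pi * x / N))⁻¹ ≤ (N : ℝ) / 2 * x⁻¹ := by
    intro x hx hx2
    have h1 : 2 / Real.pi * (Real.pi * x / N) ≤ Real.sin (Real.pi * x / N) := by
      refine Real.mul_le_sin (by positivity) ?_
      rw [div_le_div_iff₀ hN two_pos]
      nlinarith
    have h2 : 2 / Real.pi * (Real.pi * x / N) = 2 * x / N := by field_simp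
    rw [h2] at h1
    refine (inv_anti₀ (by positivity) h1).trans (le_of_eq ?_)
    rw [inv_div]
    field_simp
  have hk0 : (0 : ℝ) ≤ (k : ℝ)⁻¹ := by positivity
  have hk1 : (0 : ℝ) ≤ ((N : ℝ) - k)⁻¹ := inv_nonneg.2 (by linarith)
  rcases le_total (k : ℝ) (N / 2) with h | h
  · refine (key k hk' h).trans ?_
    gcongr
    linarith
  · have h2 := key (N - k) (by linarith) (by linarith)
    have h3 : Real.pi * (N - k) / N = Real.pi - Real.pi * k / N := by field_simp
    rw [h3, Real.sin_pi_sub] at h2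
    refine h2.trans ?_
    gcongr
    linarith

lemma norm_stdAddChar_sub_one {N : ℕ} [NeZero N] (k : ZMod N) :
    ‖ZMod.stdAddChar (-k) - 1‖ = 2 * |Real.sin (Real.pi * k.val / N)| := by
  have h1 : ZMod.stdAddChar (-k) = (starRingEnd ℂ) (ZMod.stdAddChar k) :=
    AddChar.map_neg_eq_conj _ _
  have h2 : ZMod.stdAddChar k = Complex.exp (2 * Real.pi * Complex.I * k.val / N) := by
    have := ZMod.stdAddChar_coe (N := N) (k.val : ℤ)
    simpa using this
  have h3 : ZMod.stdAddChar (-k) - 1 = (starRingEnd ℂ) (ZMod.stdAddChar k - 1) := by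
    rw [h1, map_sub, map_one]
  rw [h3, RCLike.norm_conj, h2]
  have h4 : (2 * Real.pi * Complex.I * k.val / N : ℂ) =
      Complex.I * ((2 * (Real.pi * k.val / N) : ℝ) : ℂ) := by
    push_cast; ring
  rw [h4, Complex.norm_exp_I_mul_ofReal_sub_one]
  rw [norm_mul, Real.norm_eq_abs, Real.norm_eq_abs, abs_two]
  congr 3
  ring

lemma sum_inv_le_one_add_log (N : ℕ) : ∑ k ∈ Ico 1 N, (k : ℝ)⁻¹ ≤ 1 + Real.log N := by
  rcases Nat.eq_zero_or_pos N with rfl | hN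
  · simp
  have h := harmonic_le_one_add_log N
  refine le_trans ?_ h
  rw [harmonic]
  push_cast
  rw [sum_Ico_eq_sum_range]
  refine (sum_le_sum_of_subset_of_nonneg (range_subset_range.2 (Nat.sub_le N 1)) fun _ _ _ => ?_).trans
    (le_of_eq (sum_congr rfl fun k _ => ?_)) <;> push_cast
  · positivity
  · rw [add_comm]

/-- The nonzero Fourier coefficients are geometric sums bounded by `1 / sin (πk/N)`. Their total is
harmonic, while the coefficient at 0 contributes at most 1. -/
lemma hasCharBound_window {N t : ℕ} [NeZero N] (ht : t ≤ N) :
    HasCharBound (fun z : ZMod N => if z.val < t then (1 : ℂ) else 0) (2 + Real.log N) := by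
  refine (hasCharBound_dft _).mono ?_
  have hN : (0 : ℝ) < N := by exact_mod_cast NeZero.pos N
  set f : ZMod N → ℂ := fun z => if z.val < t then (1 : ℂ) else 0 with hf
  have hdft : ∀ k : ZMod N, ZMod.dft f k = ∑ j ∈ range t, (ZMod.stdAddChar (-k)) ^ j := by
    intro k
    have h1 : ∀ j : ZMod N, ZMod.stdAddChar (-(j * k)) • f j =
        (fun i : ℕ => if i < t then (ZMod.stdAddChar (-k)) ^ i else 0) j.val := by
      intro j
      simp only [hf, smul_eq_mul, mul_ite, mul_one, mul_zero]
      rw [← AddChar.map_nsmul_eq_pow]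
      congr 2
      simp
    rw [ZMod.dft_apply, sum_congr rfl fun j _ => h1 j,
      sum_zmod_val N fun i : ℕ => if i < t then (ZMod.stdAddChar (-k)) ^ i else 0, ← sum_filter]
    congr 1
    ext i
    simp only [mem_filter, mem_range]
    omega
  set g : ℕ → ℝ := fun k => if k = 0 then 1 else
    1 / 2 * ((k : ℝ)⁻¹ + ((N : ℝ) - k)⁻¹) with hg
  have hle : ∀ k : ZMod N, ‖(N : ℂ)⁻¹ * ZMod.dft f k‖ ≤ g k.val := by
    intro k
    rw [norm_mul, norm_inv, Complex.norm_natCast, inv_mul_le_iff₀ hN, hdft]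
    by_cases hk : k = 0
    · subst hk
      simp only [hg, neg_zero, AddChar.map_zero_eq_one, one_pow, sum_const, card_range,
        nsmul_eq_mul, mul_one, Complex.norm_natCast, ZMod.val_zero, if_true]
      exact_mod_cast ht
    · have hkv : 0 < k.val := Nat.pos_of_ne_zero ((ZMod.val_ne_zero k).2 hk)
      have hkN : k.val < N := ZMod.val_lt k
      simp only [hg, hkv.ne', if_false]
      have hs : 0 < Real.sin (Real.pi * k.val / N) := by
        have hkr : (0 : ℝ) < k.val := by exact_mod_cast hkv
        have hkr' : (k.val : ℝ) < N := by exact_mod_cast hkN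
        refine Real.sin_pos_of_pos_of_lt_pi (by positivity) ?_
        rw [div_lt_iff₀ hN]
        exact mul_lt_mul_of_pos_left hkr' Real.pi_pos
      have h1 := norm_geom_sum_mul_le (AddChar.norm_apply ZMod.stdAddChar (-k)) t
      rw [norm_stdAddChar_sub_one, abs_of_pos hs] at h1
      have h2 : ‖∑ j ∈ range t, (ZMod.stdAddChar (-k)) ^ j‖ ≤
          (Real.sin (Real.pi * k.val / N))⁻¹ := by
        rw [← one_div, le_div_iff₀ hs]
        linarith
      refine h2.trans ((inv_sin_le hkv hkN).trans (le_of_eq ?_))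
      ring
  refine (sum_le_sum fun k _ => hle k).trans ?_
  rw [sum_zmod_val N g, range_eq_Ico, sum_eq_sum_Ico_succ_bot (NeZero.pos N)]
  have hrest : ∑ k ∈ Ico (0 + 1) N, g k =
      1 / 2 * (∑ k ∈ Ico 1 N, (k : ℝ)⁻¹ + ∑ k ∈ Ico 1 N, ((N : ℝ) - k)⁻¹) := by
    rw [← sum_add_distrib, mul_sum]
    refine sum_congr rfl fun k hk => ?_
    simp only [mem_Ico] at hk
    simp only [hg, show k ≠ 0 by omega, if_false]
  have hrefl : ∑ k ∈ Ico 1 N, ((N : ℝ) - k)⁻¹ = ∑ k ∈ Ico 1 N, (k : ℝ)⁻¹ := by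
    refine sum_nbij' (fun k => N - k) (fun k => N - k) ?_ ?_ ?_ ?_ ?_ <;> intro k hk <;>
      simp only [mem_Ico] at hk ⊢ <;> try omega
    rw [Nat.cast_sub hk.2.le]
  rw [hrest, hrefl]
  have := sum_inv_le_one_add_log N
  simp only [hg, if_true]
  linarith

end Windows

/-! ### Energy as a sum over parallelograms. -/

section Energy

variable {G : Type*} [AddCommGroup G] [Fintype G]

lemma sum_sum_mul_shift (g : G → ℝ) : ∑ e, ∑ j, g j * g (j + e) = (∑ j, g j) ^ 2 := by
  rw [sum_comm, sq, sum_mul]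
  refine sum_congr rfl fun j _ => ?_
  rw [← mul_sum]
  congr 1
  exact Fintype.sum_equiv (Equiv.addLeft j) _ _ fun _ => rfl

variable {H : AddSubgroup G} {a : G → ℝ}

/-- On a degenerate parallelogram the entries cancel in pairs, giving 1. Inclusion-exclusion writes
the indicator of `u ∈ H ∨ e ∈ H`. -/
lemma ShiftAdd.parallelogram_eq (ha : ShiftAdd H a) (j u e : G) : open Classical in
    a j * a (j + u) * (a (j + e) * a (j + u + e)) = parallelogramDefect H a j u e +
      ((1 + (Nat.card H : ℝ) / Fintype.card G) * ((if u ∈ H then 1 else 0) +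
        (if e ∈ H then 1 else 0) - (if u ∈ H then (if e ∈ H then 1 else 0) else 0)) -
        (Nat.card H : ℝ) / Fintype.card G) := by
  classical
  have h1 : u ∈ H ∨ e ∈ H → a j * a (j + u) * (a (j + e) * a (j + u + e)) = 1 := by
    rintro (h | h)
    · rw [ha.invariant u h, add_right_comm, ha.invariant u h, ha.mul_self, ha.mul_self, one_mul]
    · rw [ha.invariant e h, ha.invariant e h, mul_mul_mul_comm, ha.mul_self, ha.mul_self, one_mul]
  by_cases hu : u ∈ H
  · rw [h1 (Or.inl hu)]
    by_cases he : e ∈ H <;> simp [parallelogramDefect, hu, he]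
  · by_cases he : e ∈ H
    · rw [h1 (Or.inr he)]
      simp [parallelogramDefect, hu, he]
    · simp [parallelogramDefect, hu, he]

-- The conditions `u ∈ H` and `e ∈ H` contribute equally, whence the factor 2. Their overlap is only
-- bounded, by `|H|² |G|`, and the defect is bounded through its Fourier coefficients.
open Classical in
lemma ShiftAdd.abs_energy_sub_le (ha : ShiftAdd H a) {F : G → ℝ} (hF : ∀ j, |F j| ≤ 1) {B : ℝ}
    (hB : HasCharBound (fun j => (F j : ℂ)) B) :
    |∑ u, (∑ j, F j * a j * (F (j + u) * a (j + u))) ^ 2 -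
      (2 * (1 + (Nat.card H : ℝ) / Fintype.card G) *
        (∑ u, if u ∈ H then (∑ j, F j * F (j + u)) ^ 2 else 0) -
        (Nat.card H : ℝ) / Fintype.card G * ∑ u, (∑ j, F j * F (j + u)) ^ 2)| ≤
    B ^ 4 * √(((Fintype.card G : ℝ) + Nat.card H) * Nat.card H) ^ 3 +
      (1 + (Nat.card H : ℝ) / Fintype.card G) * ((Nat.card H : ℝ) ^ 2 * Fintype.card G) := by
  set w : ℝ := (Nat.card H : ℝ) / Fintype.card G with hw
  have hw0 : 0 ≤ w := by positivity
  set P : G → G → G → ℝ := fun j u e => F j * F (j + u) * (F (j + e) * F (j + u + e)) with hP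
  have hsum : ∀ u, ∑ e, ∑ j, P j u e = (∑ j, F j * F (j + u)) ^ 2 := by
    intro u
    rw [← sum_sum_mul_shift]
    refine sum_congr rfl fun e _ => sum_congr rfl fun j _ => ?_
    simp only [hP]
    rw [add_right_comm j u e]
  have hsymm : ∀ j u e, P j u e = P j e u := by
    intro j u e
    simp only [hP]
    rw [add_right_comm j u e]
    ring
  have hE : ∑ u, (∑ j, F j * a j * (F (j + u) * a (j + u))) ^ 2 =
      ∑ u, ∑ e, ∑ j, P j u e * (a j * a (j + u) * (a (j + e) * a (j + u + e))) := by
    refine sum_congr rfl fun u _ => ?_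
    rw [← sum_sum_mul_shift]
    refine sum_congr rfl fun e _ => sum_congr rfl fun j _ => ?_
    simp only [hP]
    rw [add_right_comm j u e]
    ring
  set D : ℝ := ∑ u, ∑ e, ∑ j, P j u e * parallelogramDefect H a j u e with hD
  set R : ℝ := ∑ u, ∑ e, if u ∈ H then (if e ∈ H then ∑ j, P j u e else 0) else 0 with hR
  have hsplit : ∑ u, (∑ j, F j * a j * (F (j + u) * a (j + u))) ^ 2 = D + ((1 + w) *
      ((∑ u, if u ∈ H then (∑ j, F j * F (j + u)) ^ 2 else 0) +
        (∑ u, if u ∈ H then (∑ j, F j * F (j + u)) ^ 2 else 0) - R) -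
      w * ∑ u, (∑ j, F j * F (j + u)) ^ 2) := by
    have h1 : (∑ u, if u ∈ H then (∑ j, F j * F (j + u)) ^ 2 else 0) =
        ∑ u, ∑ e, ∑ j, P j u e * (if u ∈ H then 1 else 0) := by
      refine sum_congr rfl fun u _ => ?_
      simp only [← sum_mul, hsum]
      split_ifs <;> simp
    have h2 : (∑ u, if u ∈ H then (∑ j, F j * F (j + u)) ^ 2 else 0) =
        ∑ u, ∑ e, ∑ j, P j u e * (if e ∈ H then 1 else 0) := by
      rw [h1, sum_comm]
      exact sum_congr rfl fun u _ => sum_congr rfl fun e _ => sum_congr rfl fun j _ => by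
        rw [hsymm]
    have h3 : R = ∑ u, ∑ e, ∑ j, P j u e * (if u ∈ H then (if e ∈ H then 1 else 0) else 0) := by
      refine sum_congr rfl fun u _ => sum_congr rfl fun e _ => ?_
      rw [← sum_mul]
      split_ifs <;> simp
    rw [h3]
    -- One of the two equal terms is read as the sum over `e ∈ H`, so that the identity holds
    -- summand by summand.
    nth_rw 2 [h2]
    rw [h1, hE, hD, ← sum_congr rfl fun u _ => hsum u]
    simp only [mul_sum, ← sum_add_distrib, ← sum_sub_distrib]
    refine sum_congr rfl fun u _ => sum_congr rfl fun e _ => sum_congr rfl fun j _ => ?_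
    rw [ha.parallelogram_eq]
    ring
  have hDle : |D| ≤ B ^ 4 * √(((Fintype.card G : ℝ) + Nat.card H) * Nat.card H) ^ 3 := by
    have h := hB.norm_parallelogram_sum_le (fun j u e => (parallelogramDefect H a j u e : ℂ))
      ha.norm_char_parallelogramDefect_le
    refine le_of_eq_of_le ?_ h
    rw [← Real.norm_eq_abs, ← Complex.norm_real]
    congr 1
    simp only [hD, hP]
    push_cast
    rfl
  have hRle : |R| ≤ (Nat.card H : ℝ) ^ 2 * Fintype.card G := by
    have hPle : ∀ j u e, |P j u e| ≤ 1 := by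
      intro j u e
      simp only [hP, abs_mul]
      exact mul_le_one₀ (mul_le_one₀ (hF _) (abs_nonneg _) (hF _)) (by positivity)
        (mul_le_one₀ (hF _) (abs_nonneg _) (hF _))
    have hcard : (∑ u : G, if u ∈ H then (1 : ℝ) else 0) = Nat.card H := by
      rw [sum_boole, Nat.card_eq_fintype_card, Fintype.card_subtype]
    have h1 : |R| ≤ ∑ u, ∑ e, (if u ∈ H then (1 : ℝ) else 0) * (if e ∈ H then 1 else 0) *
        Fintype.card G := by
      refine (abs_sum_le_sum_abs _ _).trans (sum_le_sum fun u _ => ?_)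
      refine (abs_sum_le_sum_abs _ _).trans (sum_le_sum fun e _ => ?_)
      split_ifs <;> simp
      refine (abs_sum_le_sum_abs _ _).trans ((sum_le_sum fun j _ => hPle j u e).trans ?_)
      simp
    refine h1.trans (le_of_eq ?_)
    simp only [← sum_mul, ← mul_sum, hcard]
    ring
  rw [hsplit]
  calc _ = |D + -((1 + w) * R)| := by congr 1; ring
    _ ≤ |D| + |-((1 + w) * R)| := abs_add_le _ _
    _ ≤ _ := by
      rw [abs_neg, abs_mul, abs_of_nonneg (by positivity : 0 ≤ 1 + w)]
      gcongr

end Energy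

/-! ### From cyclic groups to aperiodic correlations. -/

section Sequences

/-- Aperiodic autocorrelation at shift `u` of the first `t` terms of a real sequence. -/
def aperiodicCorr (x : ℕ → ℝ) (t u : ℕ) : ℝ := ∑ j ∈ range (t - u), x j * x (j + u)

/-- The first `t` terms of `x`, padded by zeros to a function on `ℤ/N`. -/
def pad (N t : ℕ) (x : ℕ → ℝ) (z : ZMod N) : ℝ := if z.val < t then x z.val else 0

lemma sum_pad_mul_pad {N : ℕ} [NeZero N] {t : ℕ} (x : ℕ → ℝ) (htN : 2 * t ≤ N) (u : ZMod N) (hu : u.val ≤ N - t) :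
    ∑ j, pad N t x j * pad N t x (j + u) = aperiodicCorr x t u.val := by
  have h1 : ∀ j : ZMod N, pad N t x j * pad N t x (j + u) =
      (fun k => if k < t - u.val then x k * x (k + u.val) else 0) j.val := by
    intro j
    simp only [pad]
    by_cases hj : j.val < t
    · have hv : (j + u).val = j.val + u.val := ZMod.val_add_of_lt (by omega)
      rw [if_pos hj, hv]
      by_cases h : j.val + u.val < t
      · rw [if_pos h, if_pos (by omega)]
      · rw [if_neg h, if_neg (by omega), mul_zero]
    · rw [if_neg hj, if_neg (show ¬ j.val < t - u.val by omega), zero_mul]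
  rw [sum_congr rfl fun j _ => h1 j,
    sum_zmod_val N fun k => if k < t - u.val then x k * x (k + u.val) else 0, ← sum_filter,
    aperiodicCorr]
  congr 1
  ext k
  simp only [mem_filter, mem_range]
  omega

/-- The residues above `N - t` are the negatives of `1, …, t-1`; `2t ≤ N` keeps the two ranges
disjoint. -/
lemma sum_even_function_zmod {N : ℕ} [NeZero N] {t : ℕ} (ht : 0 < t) (htN : 2 * t ≤ N) (g : ZMod N → ℝ)
    (heven : ∀ z, g (-z) = g z) (hzero : ∀ z, t ≤ z.val → z.val ≤ N - t → g z = 0) :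
    ∑ z, g z = g 0 + 2 * ∑ u ∈ Ico 1 t, g u := by
  have h0 : ∑ z : ZMod N, g z = ∑ k ∈ range N, g k := by
    rw [← sum_zmod_val N fun k => g k]
    simp
  rw [h0, range_eq_Ico, sum_eq_sum_Ico_succ_bot (NeZero.pos N),
    ← sum_Ico_consecutive _ (show 0 + 1 ≤ t by omega) (show t ≤ N by omega),
    ← sum_Ico_consecutive _ (show t ≤ N - t + 1 by omega) (show N - t + 1 ≤ N by omega)]
  have h1 : ∑ k ∈ Ico t (N - t + 1), g k = 0 := by
    refine sum_eq_zero fun k hk => ?_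
    simp only [mem_Ico] at hk
    have hv : (k : ZMod N).val = k := ZMod.val_cast_of_lt (by omega)
    exact hzero _ (by omega) (by omega)
  have h2 : ∑ k ∈ Ico (N - t + 1) N, g k = ∑ k ∈ Ico 1 t, g k := by
    refine sum_nbij' (fun k => N - k) (fun k => N - k) ?_ ?_ ?_ ?_ ?_ <;> intro k hk <;>
      simp only [mem_Ico] at hk ⊢ <;> try omega
    rw [← heven, Nat.cast_sub hk.2.le]
    simp
  rw [h1, h2]
  simp only [Nat.cast_zero, zero_add]
  ring

lemma sum_sq_periodicCorr_pad {N : ℕ} [NeZero N] {t : ℕ} (ht : 0 < t) (htN : 2 * t ≤ N) (x : ℕ → ℝ)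
    (P : ZMod N → Prop) [DecidablePred P] (hP : ∀ z, P (-z) ↔ P z) :
    (∑ u, if P u then (∑ j, pad N t x j * pad N t x (j + u)) ^ 2 else 0) =
      (if P 0 then aperiodicCorr x t 0 ^ 2 else 0) +
        2 * ∑ u ∈ Ico 1 t, if P (u : ZMod N) then aperiodicCorr x t u ^ 2 else 0 := by
  have heven : ∀ z : ZMod N, ∑ j, pad N t x j * pad N t x (j + -z) =
      ∑ j, pad N t x j * pad N t x (j + z) := by
    intro z
    refine Fintype.sum_equiv (Equiv.addRight (-z)) _ _ fun j => ?_
    simp [mul_comm]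
  rw [sum_even_function_zmod ht htN]
  · rw [sum_pad_mul_pad x htN 0 (by simp), ZMod.val_zero]
    congr 2
    refine sum_congr rfl fun u hu => ?_
    simp only [mem_Ico] at hu
    have hv : (u : ZMod N).val = u := ZMod.val_cast_of_lt (by omega)
    rw [sum_pad_mul_pad x htN u (by omega), hv]
  · intro z
    simp only [hP, heven]
  · intro z h1 h2
    rw [sum_pad_mul_pad x htN z h2, aperiodicCorr, Nat.sub_eq_zero_of_le h1]
    simp

/-- A `±1` sequence with period `n`, period sum `-1` and the shift-and-add property. -/
structure IsShiftAddSeq (n : ℕ) (a : ℕ → ℝ) : Prop where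
  mul_self : ∀ j, a j * a j = 1
  periodic : Function.Periodic a n
  exists_shift : ∀ u, ¬ n ∣ u → ∃ v, ∀ j, a j * a (j + u) = a (j + v)
  sum_eq : ∑ j ∈ range n, a j = -1

lemma periodic_val_add {N : ℕ} [NeZero N] {α : Type*} {g : ℕ → α} {n : ℕ} (hg : Function.Periodic g n) (hn : n ∣ N)
    (z w : ZMod N) : g (z + w).val = g (z.val + w.val) := by
  obtain ⟨L, rfl⟩ := hn
  have : Function.Periodic g (n * L) := by
    rw [mul_comm]; simpa using hg.nsmul L
  rw [ZMod.val_add, this.map_mod_nat]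

lemma sum_range_mul_of_periodic {g : ℕ → ℝ} {n : ℕ} (hg : Function.Periodic g n) (L : ℕ) :
    ∑ j ∈ range (n * L), g j = L * ∑ j ∈ range n, g j := by
  induction L with
  | zero => simp
  | succ L ih =>
    have h : ∀ x, g (n * L + x) = g x := fun x => by
      rw [add_comm, mul_comm]; simpa using hg.nsmul L x
    rw [mul_add_one, sum_range_add, ih, sum_congr rfl fun x _ => h x]
    push_cast
    ring

/-- The subgroup of multiples of `n` in `ℤ/N`, for `n ∣ N`. -/
def multiples {N : ℕ} {n : ℕ} (h : n ∣ N) : AddSubgroup (ZMod N) :=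
  (ZMod.castHom h (ZMod n)).toAddMonoidHom.ker

lemma mem_multiples {N : ℕ} [NeZero N] {n : ℕ} (h : n ∣ N) (z : ZMod N) : z ∈ multiples h ↔ n ∣ z.val := by
  rw [multiples, AddMonoidHom.mem_ker, ← ZMod.natCast_eq_zero_iff]
  simp

lemma natCast_mem_multiples {N : ℕ} {n : ℕ} (h : n ∣ N) (u : ℕ) : (u : ZMod N) ∈ multiples h ↔ n ∣ u := by
  rw [multiples, AddMonoidHom.mem_ker, ← ZMod.natCast_eq_zero_iff]
  simp

lemma card_multiples_mul {N : ℕ} {n : ℕ} (h : n ∣ N) : Nat.card (multiples h) * n = N := by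
  have h1 := AddSubgroup.card_mul_index (multiples h)
  rw [Nat.card_zmod] at h1
  have h2 : (multiples h).index = n := by
    rw [multiples, AddSubgroup.index_ker]
    have : (ZMod.castHom h (ZMod n)).toAddMonoidHom.range = ⊤ :=
      AddMonoidHom.range_eq_top.2 (ZMod.castHom_surjective h)
    rw [this, AddSubgroup.card_top, Nat.card_zmod]
  rwa [h2] at h1

/-- Lifting from period `n` to `ℤ/(nL)` turns the period sum `-1` into `-L`, and `L` is the order of
the subgroup of multiples of `n`. -/
lemma IsShiftAddSeq.shiftAdd {N : ℕ} [NeZero N] {n L : ℕ} {a : ℕ → ℝ} (ha : IsShiftAddSeq n a)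
    (hN : N = n * L) (h : n ∣ N) : ShiftAdd (multiples h) fun z : ZMod N => a z.val where
  mul_self j := ha.mul_self _
  invariant u hu j := by
    obtain ⟨k, hk⟩ := (mem_multiples h u).1 hu
    rw [periodic_val_add ha.periodic h, hk, mul_comm]
    simpa using ha.periodic.nsmul k j.val
  exists_shift u hu := by
    rw [mem_multiples] at hu
    obtain ⟨v, hv⟩ := ha.exists_shift _ hu
    refine ⟨(v : ZMod N), fun j => ?_⟩
    rw [periodic_val_add ha.periodic h, hv, periodic_val_add ha.periodic h, ZMod.val_natCast]
    have : Function.Periodic (fun k => a (j.val + k)) N := by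
      intro k
      have : Function.Periodic a N := by
        rw [hN, mul_comm]; simpa using ha.periodic.nsmul L
      simp only [← add_assoc]
      exact this _
    exact (this.map_mod_nat v).symm
  sum_eq := by
    have h0 : ∑ k ∈ range N, a k = -L := by
      rw [hN, sum_range_mul_of_periodic ha.periodic, ha.sum_eq]
      ring
    rw [sum_zmod_val N a, h0]
    have h1 := card_multiples_mul h
    have h2 : 0 < n := Nat.pos_of_dvd_of_pos h (NeZero.pos N)
    have h3 : Nat.card (multiples h) = L := by
      have : n * Nat.card (multiples h) = n * L := by rw [mul_comm, h1, hN]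
      exact Nat.eq_of_mul_eq_mul_left h2 this
    rw [h3]

/-- The padded sign pattern is a pullback from `ℤ/4`, costing a factor 4, times a window. -/
lemma hasCharBound_pad {N : ℕ} [NeZero N] {t : ℕ} (ht : t ≤ N) (h4 : 4 ∣ N) {s : ℕ → ℝ}
    (hs : Function.Periodic s 4) (hs1 : ∀ j, |s j| ≤ 1) :
    HasCharBound (fun z => (pad N t s z : ℂ)) (4 * (2 + Real.log N)) := by
  have h1 := (hasCharBound_of_norm_le_one (N := 4) (fun z => (s z.val : ℂ)) fun z => by
    rw [Complex.norm_real]; exact hs1 _).comp_hom (ZMod.castHom h4 (ZMod 4)).toAddMonoidHom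
  have h2 := h1.mul (hasCharBound_window ht)
  have h3 : ∀ z : ZMod N, (((ZMod.castHom h4 (ZMod 4)).toAddMonoidHom z : ZMod 4)).val =
      z.val % 4 := by
    intro z
    rw [← ZMod.val_natCast]
    simp
  convert h2 using 1
  · funext z
    simp only [h3, hs.map_mod_nat, pad]
    split_ifs <;> simp
  · norm_num

/-- The sum of the squared aperiodic autocorrelations over all integer shifts `u` divisible
by `m`. -/
def corrEnergy (x : ℕ → ℝ) (t m : ℕ) : ℝ :=
  aperiodicCorr x t 0 ^ 2 + 2 * ∑ u ∈ Ico 1 t, if m ∣ u then aperiodicCorr x t u ^ 2 else 0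

lemma abs_corrEnergy_sub_le {N n L t : ℕ} {a s : ℕ → ℝ} (ha : IsShiftAddSeq n a)
    (hs : Function.Periodic s 4) (hs1 : ∀ j, |s j| ≤ 1) (hN : N = n * L) (h4 : 4 ∣ N)
    (ht : 0 < t) (htN : 2 * t ≤ N) :
    |corrEnergy (fun j => s j * a j) t 1 - (2 * (1 + 1 / (n : ℝ)) * corrEnergy s t n -
      1 / (n : ℝ) * corrEnergy s t 1)| ≤
    (4 * (2 + Real.log N)) ^ 4 * √(((N : ℝ) + L) * L) ^ 3 +
      (1 + 1 / (n : ℝ)) * ((L : ℝ) ^ 2 * N) := by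
  classical
  have : NeZero N := ⟨by omega⟩
  have hd : n ∣ N := ⟨L, hN⟩
  have hn : 0 < n := Nat.pos_of_dvd_of_pos hd (NeZero.pos N)
  have hL : 0 < L := by
    rcases Nat.eq_zero_or_pos L with h | h
    · exact absurd (by simpa [h] using hN) (NeZero.ne N)
    · exact h
  have hcard : Nat.card (multiples hd) = L := by
    have : n * Nat.card (multiples hd) = n * L := by rw [mul_comm, card_multiples_mul, hN]
    exact Nat.eq_of_mul_eq_mul_left hn this
  have hF : ∀ z : ZMod N, |pad N t s z| ≤ 1 := by
    intro z
    simp only [pad]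
    split_ifs
    · exact hs1 _
    · simp
  have hw : (L : ℝ) / N = 1 / n := by
    rw [hN]
    have : (L : ℝ) ≠ 0 := by positivity
    push_cast
    field_simp
  have key := (ha.shiftAdd hN hd).abs_energy_sub_le hF (hasCharBound_pad (by omega) h4 hs hs1)
  rw [hcard, ZMod.card, hw] at key
  have e1 : ∀ z : ZMod N, pad N t s z * a z.val = pad N t (fun j => s j * a j) z := by
    intro z
    simp only [pad]
    split_ifs <;> simp
  simp only [e1] at key
  have e2 : ∀ x, ∑ u : ZMod N, (∑ j, pad N t x j * pad N t x (j + u)) ^ 2 = corrEnergy x t 1 := by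
    intro x
    have := sum_sq_periodicCorr_pad ht htN x (fun _ => True) (by simp)
    simpa [corrEnergy] using this
  have e3 : (∑ u : ZMod N, if u ∈ multiples hd then
      (∑ j, pad N t s j * pad N t s (j + u)) ^ 2 else 0) = corrEnergy s t n := by
    have := sum_sq_periodicCorr_pad ht htN s (fun z => z ∈ multiples hd) (by simp)
    rw [this, corrEnergy]
    simp [natCast_mem_multiples]
  rw [e2, e2, e3] at key
  exact key

end Sequences

/-! ### Correlation energies of sign patterns. -/

section SignSequences

/-- A `±1` sequence of period `4` with autocorrelations `±1` at the multiples of `p` and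
vanishing periodic autocorrelations at all other shifts. -/
structure IsSignSeq (p : ℕ) (s : ℕ → ℝ) : Prop where
  mul_self : ∀ j, s j * s j = 1
  periodic : Function.Periodic s 4
  const : ∀ u, p ∣ u → ∃ ε : ℝ, ε ^ 2 = 1 ∧ ∀ j, s j * s (j + u) = ε
  balanced : ∀ u, ¬ p ∣ u → ∑ j ∈ range 4, s j * s (j + u) = 0

variable {p : ℕ} {s : ℕ → ℝ}

lemma abs_eq_one_of_mul_self {x : ℝ} (h : x * x = 1) : |x| = 1 := by
  rcases mul_self_eq_one_iff.1 h with h | h <;> simp [h]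

lemma abs_sum_range_le_of_periodic {g : ℕ → ℝ} (hg : Function.Periodic g 4) (h1 : ∀ j, |g j| ≤ 1)
    (h0 : ∑ j ∈ range 4, g j = 0) (m : ℕ) : |∑ j ∈ range m, g j| ≤ 4 := by
  have hm : m = 4 * (m / 4) + m % 4 := (Nat.div_add_mod m 4).symm
  rw [hm, sum_range_add, sum_range_mul_of_periodic hg, h0, mul_zero, zero_add]
  refine (abs_sum_le_sum_abs _ _).trans ((sum_le_sum fun j _ => h1 _).trans ?_)
  have : m % 4 ≤ 4 := (Nat.mod_lt m (by norm_num)).le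
  simp only [sum_const, card_range, nsmul_eq_mul, mul_one]
  exact_mod_cast this

lemma IsSignSeq.aperiodicCorr_sq (hs : IsSignSeq p s) {t u : ℕ} (hu : u ≤ t) (h : p ∣ u) :
    aperiodicCorr s t u ^ 2 = ((t : ℝ) - u) ^ 2 := by
  obtain ⟨ε, h1, h2⟩ := hs.const u h
  rw [aperiodicCorr, sum_congr rfl fun j _ => h2 j]
  simp only [sum_const, card_range, nsmul_eq_mul]
  rw [mul_pow, h1, mul_one, Nat.cast_sub hu]

lemma IsSignSeq.aperiodicCorr_sq_le (hs : IsSignSeq p s) (t : ℕ) {u : ℕ} (h : ¬ p ∣ u) :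
    aperiodicCorr s t u ^ 2 ≤ 16 := by
  have h1 : |aperiodicCorr s t u| ≤ 4 := by
    refine abs_sum_range_le_of_periodic (fun j => ?_) (fun j => ?_) (hs.balanced u h) _
    · rw [add_right_comm, hs.periodic, hs.periodic]
    · rw [abs_mul, abs_eq_one_of_mul_self (hs.mul_self _), abs_eq_one_of_mul_self (hs.mul_self _),
        one_mul]
  rw [← sq_abs]
  nlinarith [abs_nonneg (aperiodicCorr s t u)]

/-- The sum of `(t - u)²` over the multiples `u` of `q` with `0 < u < t`. -/
def quadSum (t q : ℕ) : ℝ := ∑ u ∈ Ico 1 t, if q ∣ u then ((t : ℝ) - u) ^ 2 else 0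

/-- Among multiples of `m`, coprimality makes those divisible by `p` exactly the multiples of `p *
m`, where the autocorrelation is `±(t-u)`. Every other shift costs at most 16. -/
lemma IsSignSeq.abs_corrEnergy_sub_le (hs : IsSignSeq p s) {m : ℕ} (hm : p.Coprime m) (t : ℕ) :
    |corrEnergy s t m - ((t : ℝ) ^ 2 + 2 * quadSum t (p * m))| ≤ 32 * (t : ℝ) := by
  have h0 : aperiodicCorr s t 0 ^ 2 = (t : ℝ) ^ 2 := by
    rw [hs.aperiodicCorr_sq (Nat.zero_le t) (dvd_zero p)]; simp
  have h1 : corrEnergy s t m - ((t : ℝ) ^ 2 + 2 * quadSum t (p * m)) =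
      2 * ∑ u ∈ Ico 1 t, ((if m ∣ u then aperiodicCorr s t u ^ 2 else 0) -
        (if p * m ∣ u then ((t : ℝ) - u) ^ 2 else 0)) := by
    rw [corrEnergy, quadSum, h0, sum_sub_distrib]
    ring
  have h2 : ∀ u ∈ Ico 1 t, |(if m ∣ u then aperiodicCorr s t u ^ 2 else 0) -
      (if p * m ∣ u then ((t : ℝ) - u) ^ 2 else 0)| ≤ 16 := by
    intro u hu
    have hut : u ≤ t := (mem_Ico.1 hu).2.le
    by_cases hmu : m ∣ u
    · by_cases hpu : p ∣ u
      · rw [if_pos hmu, if_pos (hm.mul_dvd_of_dvd_of_dvd hpu hmu), hs.aperiodicCorr_sq hut hpu]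
        simp
      · rw [if_pos hmu, if_neg fun h => hpu (dvd_of_mul_right_dvd h), sub_zero,
          abs_of_nonneg (sq_nonneg _)]
        exact hs.aperiodicCorr_sq_le t hpu
    · rw [if_neg hmu, if_neg fun h => hmu (dvd_of_mul_left_dvd h)]
      simp
  rw [h1, abs_mul, abs_two]
  have h3 : |∑ u ∈ Ico 1 t, ((if m ∣ u then aperiodicCorr s t u ^ 2 else 0) -
        (if p * m ∣ u then ((t : ℝ) - u) ^ 2 else 0))| ≤ t * 16 := by
    refine (abs_sum_le_sum_abs _ _).trans ((sum_le_sum h2).trans ?_)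
    simp only [sum_const, Nat.card_Ico, nsmul_eq_mul]
    gcongr
    exact Nat.sub_le t 1
  linarith

end SignSequences

/-! ### Sums of squares along arithmetic progressions. -/

section QuadraticSums

lemma quadSum_add_self {t p : ℕ} (hp : 0 < p) :
    quadSum (t + p) p = quadSum t p + (t : ℝ) ^ 2 := by
  rw [quadSum, ← sum_Ico_consecutive _ (show 1 ≤ p by omega) (show p ≤ t + p by omega)]
  have h1 : ∑ u ∈ Ico 1 p, (if p ∣ u then (((t + p : ℕ) : ℝ) - u) ^ 2 else 0) = 0 := by
    refine sum_eq_zero fun u hu => if_neg fun h => ?_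
    rw [mem_Ico] at hu
    exact absurd (Nat.le_of_dvd (by omega) h) (by omega)
  have h2 : ∑ u ∈ Ico p (t + p), (if p ∣ u then (((t + p : ℕ) : ℝ) - u) ^ 2 else 0) =
      ∑ u ∈ Ico 0 t, (if p ∣ u then ((t : ℝ) - u) ^ 2 else 0) := by
    have := sum_Ico_add' (fun u => if p ∣ u then (((t + p : ℕ) : ℝ) - u) ^ 2 else 0) 0 t p
    rw [zero_add] at this
    rw [← this]
    refine sum_congr rfl fun u _ => ?_
    simp
  rw [h1, h2, zero_add, quadSum]
  rcases Nat.eq_zero_or_pos t with rfl | ht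
  · simp
  · rw [sum_eq_sum_Ico_succ_bot ht]
    simp [add_comm]

/-- Induction in steps of `p`: passing from `m` to `m + p` changes the difference by `-(3p²m + p³)`,
while the allowed error grows by `4p²m + 2p³`. -/
lemma abs_three_mul_quadSum_sub_le {p : ℕ} (hp : 0 < p) (t : ℕ) :
    |3 * p * quadSum t p - (t : ℝ) ^ 3| ≤ 2 * p * (t : ℝ) ^ 2 := by
  induction t using Nat.strong_induction_on with
  | _ t ih =>
  have hp' : (0 : ℝ) < p := by exact_mod_cast hp
  rcases le_or_gt t p with h | h
  · have h0 : quadSum t p = 0 := by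
      refine sum_eq_zero fun u hu => if_neg fun hd => ?_
      rw [mem_Ico] at hu
      exact absurd (Nat.le_of_dvd (by omega) hd) (by omega)
    have h' : (t : ℝ) ≤ p := by exact_mod_cast h
    rw [h0, mul_zero, zero_sub, abs_neg, abs_of_nonneg (by positivity)]
    nlinarith [sq_nonneg (t : ℝ)]
  · obtain ⟨m, rfl⟩ : ∃ m, t = m + p := ⟨t - p, by omega⟩
    have hm := ih m (by omega)
    rw [quadSum_add_self hp]
    rw [abs_le] at hm ⊢
    have hm0 : (0 : ℝ) ≤ m := by positivity
    have h1 : (0 : ℝ) ≤ (p : ℝ) ^ 2 * m := by positivity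
    have h2 : (0 : ℝ) ≤ (p : ℝ) ^ 3 := by positivity
    push_cast
    constructor <;> nlinarith [hm.1, hm.2]

/-- Partial sums of the series in the definition of `hInv`. -/
noncomputable def partialSeries (K : ℕ) (T : ℝ) : ℝ :=
  ∑ k ∈ Ico 1 K, (max 0 (1 - (k : ℝ) / T)) ^ 2

lemma quadSum_eq {t q K : ℕ} (ht : 0 < t) (hq : 0 < q) (hK : t ≤ q * K) :
    quadSum t q = (t : ℝ) ^ 2 * partialSeries K ((t : ℝ) / q) := by
  have ht' : (0 : ℝ) < t := by exact_mod_cast ht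
  have hq' : (0 : ℝ) < q := by exact_mod_cast hq
  have h1 : quadSum t q = ∑ u ∈ Ico 1 (q * K), if q ∣ u then (max 0 ((t : ℝ) - u)) ^ 2 else 0 := by
    rw [← sum_Ico_consecutive _ (show 1 ≤ t from ht) hK, quadSum]
    have : ∑ u ∈ Ico t (q * K), (if q ∣ u then (max 0 ((t : ℝ) - u)) ^ 2 else 0) = 0 := by
      refine sum_eq_zero fun u hu => ?_
      have : (t : ℝ) ≤ u := by exact_mod_cast (mem_Ico.1 hu).1
      rw [max_eq_left (by linarith)]
      simp
    rw [this, add_zero]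
    refine sum_congr rfl fun u hu => ?_
    have : (u : ℝ) ≤ t := by exact_mod_cast (mem_Ico.1 hu).2.le
    rw [max_eq_right (by linarith)]
  rw [h1, ← sum_filter, partialSeries, mul_sum]
  refine sum_nbij' (fun u => u / q) (fun k => q * k) ?_ ?_ ?_ ?_ ?_
  · intro u hu
    simp only [mem_filter, mem_Ico] at hu ⊢
    obtain ⟨⟨h2, h3⟩, k, rfl⟩ := hu
    rw [Nat.mul_div_cancel_left k hq]
    exact ⟨Nat.pos_of_ne_zero fun h => by simp [h] at h2, Nat.lt_of_mul_lt_mul_left h3⟩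
  · intro k hk
    simp only [mem_filter, mem_Ico] at hk ⊢
    exact ⟨⟨Nat.mul_pos hq hk.1, Nat.mul_lt_mul_of_pos_left hk.2 hq⟩, dvd_mul_right q k⟩
  · intro u hu
    exact Nat.mul_div_cancel' (mem_filter.1 hu).2
  · intro k _
    exact Nat.mul_div_cancel_left k hq
  · intro u hu
    obtain ⟨k, rfl⟩ := (mem_filter.1 hu).2
    rw [Nat.mul_div_cancel_left k hq, ← mul_pow]
    congr 1
    rw [mul_max_of_nonneg _ _ ht'.le, mul_zero]
    congr 1
    push_cast
    field_simp

lemma tsum_eq_partialSeries {K : ℕ} {T : ℝ} (hT : 0 < T) (hK : T ≤ K) :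
    ∑' m : ℕ+, (max 0 (1 - (m : ℝ) / T)) ^ 2 = partialSeries K T := by
  have h1 := tsum_pnat_eq_tsum_succ (f := fun m : ℕ => (max 0 (1 - (m : ℝ) / T)) ^ 2)
  rw [h1, partialSeries, sum_Ico_eq_sum_range, tsum_eq_sum (s := range (K - 1))]
  · exact sum_congr rfl fun i _ => by rw [add_comm]
  · intro i hi
    rw [mem_range, not_lt] at hi
    have h2 : (K : ℝ) ≤ (i + 1 : ℕ) := by exact_mod_cast (by omega : K ≤ i + 1)
    have h3 : 1 ≤ ((i + 1 : ℕ) : ℝ) / T := by rw [one_le_div hT]; linarith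
    rw [max_eq_left (by linarith)]
    simp

lemma tendsto_partialSeries {ι : Type*} {l : Filter ι} {τ : ι → ℝ} {T : ℝ} (hT : 0 < T)
    (hτ : Tendsto τ l (𝓝 T)) (K : ℕ) :
    Tendsto (fun i => partialSeries K (τ i)) l (𝓝 (partialSeries K T)) := by
  refine tendsto_finsetSum _ fun k _ => ?_
  exact (tendsto_const_nhds.max (tendsto_const_nhds.sub (tendsto_const_nhds.div hτ hT.ne'))).pow 2

end QuadraticSums

/-! ### Negligibility of the error term. -/

section Limits

lemma tendsto_log_div_rpow :
    Tendsto (fun x : ℝ => (2 + Real.log x) / x ^ (1 / 8 : ℝ)) atTop (𝓝 0) := by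
  have h1 : Tendsto (fun x : ℝ => Real.log x / x ^ (1 / 8 : ℝ)) atTop (𝓝 0) :=
    (isLittleO_log_rpow_atTop (by norm_num : (0 : ℝ) < 1 / 8)).tendsto_div_nhds_zero
  have h2 : Tendsto (fun x : ℝ => 2 / x ^ (1 / 8 : ℝ)) atTop (𝓝 0) :=
    tendsto_const_nhds.div_atTop (tendsto_rpow_atTop (by norm_num))
  simpa [add_div] using h2.add h1

/-- The saving `x^{-1/2}` is written as a fourth power so as to pair with the fourth power of the
logarithm. -/
lemma sqrt_pow_three_div_sq {x : ℝ} (hx : 0 < x) :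
    √x ^ 3 / x ^ 2 = 1 / (x ^ (1 / 8 : ℝ)) ^ 4 := by
  have h1 : (x ^ (1 / 8 : ℝ)) ^ 4 = √x := by
    rw [← Real.rpow_natCast, ← Real.rpow_mul hx.le, Real.sqrt_eq_rpow]
    norm_num
  have h2 : 0 < √x := Real.sqrt_pos.2 hx
  rw [h1]
  nth_rw 2 [← Real.sq_sqrt hx.le]
  field_simp

lemma error_div_sq {n L t : ℕ} (hn : 0 < n) (hL : 0 < L) (ht : 0 < t) :
    ((4 * (2 + Real.log (n * L : ℕ))) ^ 4 * √((((n * L : ℕ) : ℝ) + L) * L) ^ 3 +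
      (1 + 1 / (n : ℝ)) * ((L : ℝ) ^ 2 * (n * L : ℕ))) / (t : ℝ) ^ 2 =
    256 * ((2 + Real.log (n * L : ℕ)) / ((n * L : ℕ) : ℝ) ^ (1 / 8 : ℝ)) ^ 4 *
      √(L * (1 + 1 / (n : ℝ))) ^ 3 * (((n * L : ℕ) : ℝ) / t) ^ 2 +
      (1 + 1 / (n : ℝ)) * (L : ℝ) ^ 2 * (((n * L : ℕ) : ℝ) / t) * (1 / t) := by
  have hn' : (0 : ℝ) < n := by exact_mod_cast hn
  have ht' : (0 : ℝ) < t := by exact_mod_cast ht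
  have hN : (0 : ℝ) < (n * L : ℕ) := by exact_mod_cast Nat.mul_pos hn hL
  have h1 : (((n * L : ℕ) : ℝ) + L) * L = (n * L : ℕ) * (L * (1 + 1 / (n : ℝ))) := by
    push_cast; field_simp
  rw [h1, Real.sqrt_mul hN.le]
  have h2 := sqrt_pow_three_div_sq hN
  rw [div_eq_iff (by positivity)] at h2
  rw [mul_pow √((n * L : ℕ) : ℝ), h2]
  generalize ((n * L : ℕ) : ℝ) ^ (1 / 8 : ℝ) = y
  simp only [div_eq_mul_inv, one_mul]
  ring

end Limits

/-! ### Limits of the energy and of the merit factor. -/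

lemma hInv_eq_partialSeries {K : ℕ} {T : ℝ} (hT : 0 < T) (hK : T ≤ K) :
    hInv T = 1 - 2 * T / 3 + 4 * partialSeries K T := by
  rw [hInv, tsum_eq_partialSeries hT hK]

lemma tendsto_corrEnergy_div_sq {p : ℕ} (hp : 0 < p) {n t : ℕ → ℕ} {a s : ℕ → ℕ → ℝ} {T : ℝ}
    (hT : 0 < T) (hn : Tendsto n atTop atTop) (hpn : ∀ᶠ d in atTop, p.Coprime (n d))
    (ha : ∀ᶠ d in atTop, IsShiftAddSeq (n d) (a d)) (hs : ∀ d, IsSignSeq p (s d))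
    (ht : Tendsto (fun d => (t d : ℝ) / (p * n d)) atTop (𝓝 T)) :
    Tendsto (fun d => corrEnergy (fun j => s d j * a d j) (t d) 1 / (t d : ℝ) ^ 2) atTop
      (𝓝 (1 + hInv T)) := by
  have hp' : (0 : ℝ) < p := by exact_mod_cast hp
  obtain ⟨K, hK⟩ := exists_nat_gt T
  have hK0 : 0 < K := by
    rcases Nat.eq_zero_or_pos K with rfl | h
    · simp at hK; linarith
    · exact h
  -- The factor 4 gives `4 ∣ N`, and `K > T` gives `t ≤ pnK`, hence `2t ≤ N`, eventually. Since `L`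
  -- does not depend on `d`, `N/t` stays bounded.
  set L : ℕ := 4 * (p * K) with hLdef
  have hL : 0 < L := by positivity
  have hnR : Tendsto (fun d => (n d : ℝ)) atTop atTop := tendsto_natCast_atTop_atTop.comp hn
  have hinv : Tendsto (fun d => 1 / (n d : ℝ)) atTop (𝓝 0) :=
    tendsto_const_nhds.div_atTop hnR
  have hn0 : ∀ᶠ d in atTop, 0 < n d := hn.eventually_gt_atTop 0
  have htR : Tendsto (fun d => (t d : ℝ)) atTop atTop := by
    have h1 : Tendsto (fun d => (t d : ℝ) / (p * n d) * (p * n d)) atTop atTop :=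
      ht.pos_mul_atTop hT (hnR.const_mul_atTop hp')
    refine h1.congr' ?_
    filter_upwards [hn0] with d hd
    have : (0 : ℝ) < n d := by exact_mod_cast hd
    field_simp
  have ht0 : ∀ᶠ d in atTop, 0 < t d := by
    filter_upwards [htR.eventually_gt_atTop 0] with d hd
    exact_mod_cast hd
  have htinv : Tendsto (fun d => 1 / (t d : ℝ)) atTop (𝓝 0) :=
    tendsto_const_nhds.div_atTop htR
  have htK : ∀ᶠ d in atTop, t d ≤ p * n d * K := by
    filter_upwards [ht.eventually_lt_const hK, hn0] with d h1 h2
    have : (0 : ℝ) < n d := by exact_mod_cast h2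
    rw [div_lt_iff₀ (by positivity)] at h1
    have h3 : (t d : ℝ) ≤ p * n d * K := by linarith
    exact_mod_cast h3
  have hNt : Tendsto (fun d => ((n d * L : ℕ) : ℝ) / t d) atTop (𝓝 (L / p * T⁻¹)) := by
    refine ((ht.inv₀ hT.ne').const_mul ((L : ℝ) / p)).congr' ?_
    filter_upwards [hn0, ht0] with d h1 h2
    have : (0 : ℝ) < n d := by exact_mod_cast h1
    have : (0 : ℝ) < t d := by exact_mod_cast h2
    push_cast
    field_simp
  have hNR : Tendsto (fun d => ((n d * L : ℕ) : ℝ)) atTop atTop := by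
    push_cast
    exact hnR.atTop_mul_const (by exact_mod_cast hL)
  have hPS := tendsto_partialSeries hT ht K
  -- The main term after division by `t²`, with `quadSum t p` replaced by `t³/(3p)`.
  have hX : Tendsto (fun d => 2 * (1 + 1 / (n d : ℝ)) *
      (1 + 2 * partialSeries K ((t d : ℝ) / (p * n d))) - (1 / (n d : ℝ) +
      2 / 3 * ((t d : ℝ) / (p * n d)))) atTop (𝓝 (1 + hInv T)) := by
    have h1 := ((((tendsto_const_nhds (x := (1 : ℝ))).add hinv).const_mul 2).mul
      ((hPS.const_mul 2).const_add 1)).sub (hinv.add (ht.const_mul (2 / 3)))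
    convert h1 using 2
    rw [hInv_eq_partialSeries hT hK.le]
    ring
  have herr : Tendsto (fun d => (256 * ((2 + Real.log (n d * L : ℕ)) /
      ((n d * L : ℕ) : ℝ) ^ (1 / 8 : ℝ)) ^ 4 *
      √(L * (1 + 1 / (n d : ℝ))) ^ 3 * (((n d * L : ℕ) : ℝ) / t d) ^ 2 +
      (1 + 1 / (n d : ℝ)) * (L : ℝ) ^ 2 * (((n d * L : ℕ) : ℝ) / t d) * (1 / t d)) +
      (2 * (1 + 1 / (n d : ℝ)) * 32 * (1 / t d) + 1 / (n d : ℝ) * 32 * (1 / t d) +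
        4 / 3 * (1 / (n d : ℝ)))) atTop (𝓝 0) := by
    have h1 := (tendsto_const_nhds (x := (1 : ℝ))).add hinv
    have h2 := (tendsto_log_div_rpow.comp hNR).pow 4
    have h3 := ((((h2.const_mul 256).mul (((h1.const_mul (L : ℝ)).sqrt).pow 3)).mul
      (hNt.pow 2)).add (((h1.mul_const ((L : ℝ) ^ 2)).mul hNt).mul htinv)).add
      (((((h1.const_mul 2).mul_const 32).mul htinv).add ((hinv.mul_const 32).mul htinv)).add
        (hinv.const_mul (4 / 3)))
    simpa [Function.comp_def] using h3
  refine hX.congr_dist (squeeze_zero' (Eventually.of_forall fun _ => dist_nonneg) ?_ herr)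
  filter_upwards [hn0, ht0, htK, hpn, ha] with d hn0 ht0 htK hpn ha
  have hn' : (0 : ℝ) < n d := by exact_mod_cast hn0
  have ht' : (0 : ℝ) < t d := by exact_mod_cast ht0
  have h1 := abs_corrEnergy_sub_le ha (hs d).periodic
    (fun j => (abs_eq_one_of_mul_self ((hs d).mul_self j)).le) rfl
    (show 4 ∣ n d * L from ⟨n d * (p * K), by rw [hLdef]; ring⟩) ht0
    (show 2 * t d ≤ n d * L by rw [hLdef]; nlinarith)
  have h2 := (hs d).abs_corrEnergy_sub_le hpn (t d)
  have h3 := (hs d).abs_corrEnergy_sub_le (Nat.coprime_one_right p) (t d)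
  have h4 := abs_three_mul_quadSum_sub_le hp (t d)
  have h5 := quadSum_eq ht0 (Nat.mul_pos hp hn0) htK
  rw [← error_div_sq hn0 hL ht0]
  set Err := (4 * (2 + Real.log (n d * L : ℕ))) ^ 4 * √((((n d * L : ℕ) : ℝ) + L) * L) ^ 3 +
      (1 + 1 / (n d : ℝ)) * ((L : ℝ) ^ 2 * (n d * L : ℕ)) with hErr
  rw [mul_one] at h3
  rw [h5] at h2
  push_cast at h2
  generalize corrEnergy (fun j => s d j * a d j) (t d) 1 = S at *
  generalize corrEnergy (s d) (t d) (n d) = E₁ at *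
  generalize corrEnergy (s d) (t d) 1 = E₂ at *
  generalize partialSeries K ((t d : ℝ) / (p * n d)) = W at *
  generalize quadSum (t d) p = q at *
  rw [Real.dist_eq]
  -- Four errors: character sums, the energy of `s` at multiples of `n`, its full energy, and the
  -- cubic approximation of `quadSum`.
  have hsplit : 2 * (1 + 1 / (n d : ℝ)) * (1 + 2 * W) - (1 / (n d : ℝ) +
      2 / 3 * ((t d : ℝ) / (p * n d))) - S / (t d : ℝ) ^ 2 =
      -((S - (2 * (1 + 1 / (n d : ℝ)) * E₁ - 1 / (n d : ℝ) * E₂)) / (t d : ℝ) ^ 2) +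
      (-(2 * (1 + 1 / (n d : ℝ)) * ((E₁ - ((t d : ℝ) ^ 2 + 2 * ((t d : ℝ) ^ 2 * W))) /
        (t d : ℝ) ^ 2)) +
      (1 / (n d : ℝ) * ((E₂ - ((t d : ℝ) ^ 2 + 2 * q)) / (t d : ℝ) ^ 2) +
        2 / 3 * (1 / (n d : ℝ)) * ((3 * p * q - (t d : ℝ) ^ 3) / (p * (t d : ℝ) ^ 2)))) := by
    field_simp
    ring
  rw [hsplit]
  have b1 : |(S - (2 * (1 + 1 / (n d : ℝ)) * E₁ - 1 / (n d : ℝ) * E₂)) / (t d : ℝ) ^ 2| ≤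
      Err / (t d : ℝ) ^ 2 := by
    rw [abs_div, abs_of_pos (by positivity : (0 : ℝ) < (t d : ℝ) ^ 2)]
    gcongr
  have b2 : |2 * (1 + 1 / (n d : ℝ)) * ((E₁ - ((t d : ℝ) ^ 2 + 2 * ((t d : ℝ) ^ 2 * W))) /
        (t d : ℝ) ^ 2)| ≤ 2 * (1 + 1 / (n d : ℝ)) * 32 * (1 / t d) := by
    rw [abs_mul, abs_div, abs_of_pos (by positivity : (0 : ℝ) < (t d : ℝ) ^ 2),
      abs_of_pos (by positivity : 0 < 2 * (1 + 1 / (n d : ℝ))), mul_assoc _ (32 : ℝ)]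
    gcongr
    rw [div_le_iff₀ (by positivity)]
    refine h2.trans (le_of_eq ?_)
    field_simp
  have b3 : |1 / (n d : ℝ) * ((E₂ - ((t d : ℝ) ^ 2 + 2 * q)) / (t d : ℝ) ^ 2)| ≤
      1 / (n d : ℝ) * 32 * (1 / t d) := by
    rw [abs_mul, abs_of_pos (by positivity : 0 < 1 / (n d : ℝ)), abs_div,
      abs_of_pos (by positivity : (0 : ℝ) < (t d : ℝ) ^ 2), mul_assoc _ (32 : ℝ)]
    gcongr
    rw [div_le_iff₀ (by positivity)]
    refine h3.trans (le_of_eq ?_)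
    field_simp
  have b4 : |2 / 3 * (1 / (n d : ℝ)) * ((3 * p * q - (t d : ℝ) ^ 3) / (p * (t d : ℝ) ^ 2))| ≤
      4 / 3 * (1 / (n d : ℝ)) := by
    rw [abs_mul, abs_div, abs_of_pos (by positivity : (0 : ℝ) < p * (t d : ℝ) ^ 2),
      abs_of_pos (by positivity : 0 < 2 / 3 * (1 / (n d : ℝ))),
      show 4 / 3 * (1 / (n d : ℝ)) = 2 / 3 * (1 / (n d : ℝ)) * 2 by ring]
    gcongr
    rw [div_le_iff₀ (by positivity)]
    linarith
  refine (abs_add_le _ _).trans (add_le_add (by rwa [abs_neg]) ?_)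
  refine (abs_add_le _ _).trans ?_
  rw [abs_neg, add_assoc]
  exact add_le_add b2 ((abs_add_le _ _).trans (add_le_add b3 b4))

lemma autocorrelation_eq_aperiodicCorr {t : ℕ} (y : Fin t → ℤ) (x : ℕ → ℝ)
    (h : ∀ j : Fin t, (y j : ℝ) = x j) (u : ℕ) :
    (autocorrelation y u : ℝ) = aperiodicCorr x t u := by
  rw [autocorrelation, aperiodicCorr]
  have h1 : ∀ j : Fin t, (((if hj : (j : ℕ) + u < t then y j * y ⟨j + u, hj⟩ else 0 : ℤ)) : ℝ) =
      (fun k => if k < t - u then x k * x (k + u) else 0) j := by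
    intro j
    by_cases hj : (j : ℕ) + u < t
    · simp only [dif_pos hj, if_pos (show (j : ℕ) < t - u by omega)]
      push_cast
      rw [h, h]
    · simp only [dif_neg hj, if_neg (show ¬ (j : ℕ) < t - u by omega)]
      simp
  rw [Int.cast_sum, sum_congr rfl fun j _ => h1 j,
    Fin.sum_univ_eq_sum_range fun k => if k < t - u then x k * x (k + u) else 0, ← sum_filter]
  congr 1
  ext k
  simp only [mem_filter, mem_range]
  omega

/-- The energy includes the shift 0, which contributes `t²`; this is the subtracted 1. -/
lemma meritFactor_eq {t : ℕ} (ht : 0 < t) (y : Fin t → ℤ) (x : ℕ → ℝ)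
    (h : ∀ j : Fin t, (y j : ℝ) = x j) (hx : ∀ j, x j * x j = 1) :
    meritFactor y = (corrEnergy x t 1 / (t : ℝ) ^ 2 - 1)⁻¹ := by
  have ht' : (0 : ℝ) < t := by exact_mod_cast ht
  have h0 : aperiodicCorr x t 0 = t := by
    simp [aperiodicCorr, hx]
  have h1 : corrEnergy x t 1 / (t : ℝ) ^ 2 - 1 =
      (2 * ∑ u ∈ Ico 1 t, (autocorrelation y u : ℝ) ^ 2) / (t : ℝ) ^ 2 := by
    simp only [corrEnergy, h0, one_dvd, if_true, autocorrelation_eq_aperiodicCorr y x h]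
    field_simp
    ring
  rw [meritFactor, h1, inv_div]

lemma tendsto_meritFactor {p : ℕ} (hp : 0 < p) {n t : ℕ → ℕ} {a s : ℕ → ℕ → ℝ} {T : ℝ}
    (hT : 0 < T) (hpos : hInv T ≠ 0) (hn : Tendsto n atTop atTop)
    (hpn : ∀ᶠ d in atTop, p.Coprime (n d))
    (ha : ∀ᶠ d in atTop, IsShiftAddSeq (n d) (a d)) (hs : ∀ d, IsSignSeq p (s d))
    (ht : Tendsto (fun d => (t d : ℝ) / (p * n d)) atTop (𝓝 T))
    (y : (d : ℕ) → Fin (t d) → ℤ)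
    (hy : ∀ᶠ d in atTop, ∀ j : Fin (t d), (y d j : ℝ) = s d j * a d j) :
    Tendsto (fun d => meritFactor (y d)) atTop (𝓝 (h T)) := by
  have h1 := ((tendsto_corrEnergy_div_sq hp hT hn hpn ha hs ht).sub_const 1).inv₀
    (by simpa using hpos)
  rw [add_sub_cancel_left, ← one_div, ← MeritFactor.h] at h1
  refine h1.congr' ?_
  have ht0 : ∀ᶠ d in atTop, 0 < t d := by
    filter_upwards [ht.eventually_const_lt hT] with d hd
    rcases Nat.eq_zero_or_pos (t d) with h | h
    · simp [h] at hd
    · exact h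
  filter_upwards [ht0, ha, hy] with d h2 h3 h4
  refine (meritFactor_eq h2 _ (fun j => s d j * a d j) h4 fun j => ?_).symm
  rw [mul_mul_mul_comm, (hs d).mul_self, h3.mul_self, one_mul]

/-! ### Shift-and-add property of Galois sequences. -/

section CanonicalCharacter

variable {d : ℕ}

lemma canonicalCharacter_add (x y : GaloisField 2 d) :
    canonicalCharacter d (x + y) = canonicalCharacter d x * canonicalCharacter d y := by
  have h : ∀ a b : ZMod 2, (-1 : ℤ) ^ (a + b).val = (-1) ^ a.val * (-1) ^ b.val := by decide
  rw [canonicalCharacter, map_add, h, canonicalCharacter, canonicalCharacter]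

lemma canonicalCharacter_mul_self (x : GaloisField 2 d) :
    canonicalCharacter d x * canonicalCharacter d x = 1 := by
  have h : ∀ a : ZMod 2, (-1 : ℤ) ^ a.val * (-1) ^ a.val = 1 := by decide
  exact h _

lemma canonicalCharacter_zero : canonicalCharacter d 0 = 1 := by
  simp [canonicalCharacter]

lemma exists_canonicalCharacter_eq_neg_one (d : ℕ) : ∃ b, canonicalCharacter d b = -1 := by
  obtain ⟨b, hb⟩ := Algebra.trace_surjective (ZMod 2) (GaloisField 2 d) 1
  exact ⟨b, by rw [canonicalCharacter, hb]; rfl⟩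

/-- Translation by an element where the character is `-1` negates the sum. -/
lemma sum_canonicalCharacter [Fintype (GaloisField 2 d)] : ∑ y, canonicalCharacter d y = 0 := by
  obtain ⟨b, hb⟩ := exists_canonicalCharacter_eq_neg_one d
  have h : ∑ y, canonicalCharacter d (y + b) = ∑ y, canonicalCharacter d y :=
    Fintype.sum_equiv (Equiv.addRight b) _ _ fun _ => rfl
  simp only [canonicalCharacter_add, hb, ← sum_mul] at h
  linarith

lemma sum_units_canonicalCharacter [Fintype (GaloisField 2 d)ˣ] :
    ∑ y : (GaloisField 2 d)ˣ, canonicalCharacter d y = -1 := by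
  classical
  have : Fintype (GaloisField 2 d) := Fintype.ofFinite _
  have h1 := sum_canonicalCharacter (d := d)
  rw [Fintype.sum_eq_add_sum_subtype_ne _ (0 : GaloisField 2 d), canonicalCharacter_zero] at h1
  have h2 : ∑ y : (GaloisField 2 d)ˣ, canonicalCharacter d y =
      ∑ y : {y : GaloisField 2 d // y ≠ 0}, canonicalCharacter d y :=
    Fintype.sum_equiv unitsEquivNeZero _ _ fun _ => rfl
  rw [h2]
  linarith

variable {θ : (GaloisField 2 d)ˣ}

lemma IsPrimitiveElement.orderOf_eq (hθ : IsPrimitiveElement θ) (hd : 1 ≤ d) :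
    orderOf θ = 2 ^ d - 1 := by
  rw [← Nat.card_zpowers, hθ, Subgroup.card_top, Nat.card_units,
    GaloisField.card 2 d (by omega)]

lemma IsPrimitiveElement.exists_pow_eq (hθ : IsPrimitiveElement θ) (w : (GaloisField 2 d)ˣ) :
    ∃ v : ℕ, θ ^ v = w := by
  have h : w ∈ Subgroup.zpowers θ := by rw [hθ]; trivial
  exact mem_powers_iff_mem_zpowers.2 h

/-- The values of the canonical character along the powers of `θ`, starting from `θ ^ r`. -/
noncomputable def galoisShift (θ : (GaloisField 2 d)ˣ) (r : ℤ) (j : ℕ) : ℝ :=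
  (canonicalCharacter d ((θ ^ ((j : ℤ) + r) : (GaloisField 2 d)ˣ) : GaloisField 2 d) : ℝ)

/-- If `θ^u ≠ 1` then `1 + θ^u` is nonzero in characteristic 2, hence a power `θ^v`; this `v` is the
new shift. A period runs through all nonzero elements, so its sum is `-ψ(0) = -1`. -/
lemma IsPrimitiveElement.isShiftAddSeq (hθ : IsPrimitiveElement θ) (hd : 1 ≤ d) (r : ℤ) :
    IsShiftAddSeq (2 ^ d - 1) (galoisShift θ r) where
  mul_self j := by
    rw [galoisShift]
    exact_mod_cast canonicalCharacter_mul_self _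
  periodic j := by
    have h : θ ^ (2 ^ d - 1) = 1 := by rw [← hθ.orderOf_eq hd, pow_orderOf_eq_one]
    rw [galoisShift, galoisShift, Nat.cast_add, add_right_comm, zpow_add, zpow_natCast θ (_ - _), h,
      mul_one]
  exists_shift u hu := by
    have h1 : θ ^ u ≠ 1 := by
      rwa [Ne, ← orderOf_dvd_iff_pow_eq_one, hθ.orderOf_eq hd]
    have h2 : (1 : GaloisField 2 d) + ((θ ^ u : (GaloisField 2 d)ˣ) : GaloisField 2 d) ≠ 0 := by
      intro h
      apply h1
      have h3 := CharTwo.add_eq_zero.1 h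
      exact Units.ext h3.symm
    obtain ⟨v, hv⟩ := hθ.exists_pow_eq (Units.mk0 _ h2)
    refine ⟨v, fun j => ?_⟩
    simp only [galoisShift]
    rw [Nat.cast_add, add_right_comm, zpow_add θ _ (u : ℤ), zpow_natCast θ u, Nat.cast_add,
      add_right_comm (j : ℤ) (v : ℤ), zpow_add θ _ (v : ℤ), zpow_natCast θ v, hv]
    have h4 := canonicalCharacter_add
      ((θ ^ ((j : ℤ) + r) : (GaloisField 2 d)ˣ) : GaloisField 2 d)
      (((θ ^ ((j : ℤ) + r) : (GaloisField 2 d)ˣ) : GaloisField 2 d) *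
        ((θ ^ u : (GaloisField 2 d)ˣ) : GaloisField 2 d))
    rw [Units.val_mul, Units.val_mul, Units.val_mk0, mul_add, mul_one, h4]
    push_cast
    rfl
  sum_eq := by
    classical
    have : Fintype (GaloisField 2 d)ˣ := Fintype.ofFinite _
    have hmem : ∀ x, x ∈ Subgroup.zpowers θ := fun x => by rw [hθ]; trivial
    have h1 : ∑ w : (GaloisField 2 d)ˣ,
        canonicalCharacter d ((w * θ ^ r : (GaloisField 2 d)ˣ) : GaloisField 2 d) = -1 := by
      rw [← sum_units_canonicalCharacter (d := d)]
      exact Fintype.sum_equiv (Equiv.mulRight (θ ^ r)) _ _ fun _ => rfl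
    rw [← IsCyclic.image_range_orderOf hmem, sum_image, hθ.orderOf_eq hd] at h1
    · simp only [galoisShift, zpow_add, zpow_natCast]
      exact_mod_cast h1
    · intro i hi j hj hij
      exact pow_injOn_Iio_orderOf (by simpa using hi) (by simpa using hj) hij

end CanonicalCharacter

/-! ### The three sign patterns. -/

section Signs

/-- Because `p ∣ 4`, both the values of `s` and the condition `p ∣ u` depend only on residues modulo
4. -/
lemma IsSignSeq.of_finite_check {p : ℕ} (hp : p ∣ 4) {s : ℕ → ℤ} (hs : Function.Periodic s 4)
    (h1 : ∀ j < 4, s j * s j = 1)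
    (h2 : ∀ u < 4, p ∣ u → ∀ j < 4, s j * s (j + u) = s 0 * s u)
    (h3 : ∀ u < 4, ¬ p ∣ u → ∑ j ∈ range 4, s j * s (j + u) = 0) :
    IsSignSeq p fun j => (s j : ℝ) := by
  have hmod : ∀ j u, s (j + u) = s (j + u % 4) := by
    intro j u
    rw [← hs.map_mod_nat (j + u), ← hs.map_mod_nat (j + u % 4), Nat.add_mod_mod]
  have hmod' : ∀ j u, s (j + u) = s (j % 4 + u % 4) := by
    intro j u
    rw [← hs.map_mod_nat (j + u), ← hs.map_mod_nat (j % 4 + u % 4), Nat.add_mod]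
  have hlt : ∀ j, j % 4 < 4 := fun j => Nat.mod_lt _ (by norm_num)
  have hsq : ∀ j, s j * s j = 1 := fun j => by
    rw [← hs.map_mod_nat j]; exact h1 _ (hlt j)
  refine ⟨fun j => by exact_mod_cast hsq j, fun j => by simp only [hs j], fun u hu => ?_,
    fun u hu => ?_⟩
  · refine ⟨((s 0 * s (u % 4) : ℤ) : ℝ), ?_, fun j => ?_⟩
    · have : (s 0 * s (u % 4)) ^ 2 = 1 := by
        rw [mul_pow, sq, sq, hsq, hsq, one_mul]
      exact_mod_cast this
    · have := h2 (u % 4) (hlt u) ((Nat.dvd_mod_iff hp).2 hu) (j % 4) (hlt j)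
      rw [hs.map_mod_nat, ← hmod'] at this
      exact_mod_cast this
  · have := h3 (u % 4) (hlt u) (fun h => hu ((Nat.dvd_mod_iff hp).1 h))
    simp only [← hmod] at this
    exact_mod_cast this

lemma IsSignSeq.shift {p : ℕ} {s : ℕ → ℝ} (hs : IsSignSeq p s) (r : ℕ) :
    IsSignSeq p fun j => s (j + r) where
  mul_self j := hs.mul_self _
  periodic j := by simp only [add_right_comm j 4 r, hs.periodic (j + r)]
  const u hu := by
    obtain ⟨ε, h1, h2⟩ := hs.const u hu
    exact ⟨ε, h1, fun j => by rw [add_right_comm, h2]⟩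
  -- Sliding the window of four terms by one drops a term and adds an equal one.
  balanced u hu := by
    induction r with
    | zero => exact hs.balanced u hu
    | succ r ih =>
      have h1 : s (r + 4) = s r := hs.periodic r
      have h2 : s (r + 4 + u) = s (r + u) := by rw [add_right_comm, hs.periodic]
      simp only [sum_range_succ, sum_range_zero] at ih ⊢
      simp only [show ∀ k, k + u + (r + 1) = r + (k + 1) + u by intros; ring,
        show ∀ k, k + (r + 1) = r + (k + 1) by intros; ring] at ih ⊢
      simp only [show ∀ k, k + u + r = r + k + u by intros; ring, add_comm _ r] at ih
      norm_num at ih ⊢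
      rw [h1, h2]
      linarith

/-- The signs `+ + - -`. -/
def negaperiodicSign (j : ℕ) : ℤ := (-1) ^ (j * (j - 1) / 2)

/-- The signs `+ + - +`. -/
def periodicSign (j : ℕ) : ℤ := (-1) ^ (j * (j - 1) ^ 2 / 2)

lemma negaperiodicSign_periodic : Function.Periodic negaperiodicSign 4 := by
  intro j
  have h : (j + 4) * (j + 4 - 1) / 2 = j * (j - 1) / 2 + 2 * (2 * j + 3) := by
    -- The case `j = 0` is separate because `j - 1` is truncated there.
    rcases j with _ | j
    · rfl
    · have : (j + 1 + 4) * (j + 1 + 4 - 1) = (j + 1) * (j + 1 - 1) + 2 * (2 * (2 * (j + 1) + 3)) := by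
        simp only [Nat.add_sub_cancel, show j + 1 + 4 - 1 = j + 4 by omega]
        ring
      rw [this, Nat.add_mul_div_left _ _ two_pos]
  rw [negaperiodicSign, negaperiodicSign, h, pow_add, pow_mul]
  simp

lemma periodicSign_periodic : Function.Periodic periodicSign 4 := by
  intro j
  have h : (j + 4) * (j + 4 - 1) ^ 2 / 2 =
      j * (j - 1) ^ 2 / 2 + 2 * (3 * j ^ 2 + 8 * j + 9) := by
    rcases j with _ | j
    · rfl
    · have : (j + 1 + 4) * (j + 1 + 4 - 1) ^ 2 =
          (j + 1) * (j + 1 - 1) ^ 2 + 2 * (2 * (3 * (j + 1) ^ 2 + 8 * (j + 1) + 9)) := by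
        simp only [Nat.add_sub_cancel, show j + 1 + 4 - 1 = j + 4 by omega]
        ring
      rw [this, Nat.add_mul_div_left _ _ two_pos]
  rw [periodicSign, periodicSign, h, pow_add, pow_mul]
  simp

lemma isSignSeq_one : IsSignSeq 1 fun _ => ((1 : ℤ) : ℝ) :=
  IsSignSeq.of_finite_check (s := fun _ => 1) (by norm_num) (fun _ => rfl) (by decide) (by decide)
    (by simp)

lemma isSignSeq_negaperiodicSign : IsSignSeq 2 fun j => (negaperiodicSign j : ℝ) :=
  IsSignSeq.of_finite_check (by norm_num) negaperiodicSign_periodic (by decide) (by decide)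
    (by decide)

lemma isSignSeq_periodicSign : IsSignSeq 4 fun j => (periodicSign j : ℝ) :=
  IsSignSeq.of_finite_check (by norm_num) periodicSign_periodic (by decide) (by decide)
    (by decide)

end Signs

/-! ### Rotated sequences as sign pattern times Galois sequence. -/

section Rotations

variable {d : ℕ} {θ : (GaloisField 2 d)ˣ}

lemma two_pow_sub_one_pos (hd : 1 ≤ d) : 0 < 2 ^ d - 1 := by
  have := Nat.one_lt_two_pow (n := d) (by omega)
  omega

lemma periodicExtension_galoisSequence (hθ : IsPrimitiveElement θ) (hd : 1 ≤ d) (m : ℤ) :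
    periodicExtension (galoisSequence d θ) m =
      canonicalCharacter d ((θ ^ m : (GaloisField 2 d)ˣ) : GaloisField 2 d) := by
  have hn := two_pow_sub_one_pos hd
  rw [periodicExtension, dif_pos hn, galoisSequence]
  congr 1
  have h0 : (0 : ℤ) ≤ m % ((2 ^ d - 1 : ℕ) : ℤ) := Int.emod_nonneg _ (by omega)
  have h1 : θ ^ m = θ ^ (m % ((2 ^ d - 1 : ℕ) : ℤ)).toNat := by
    rw [← zpow_natCast, Int.toNat_of_nonneg h0, ← hθ.orderOf_eq hd, zpow_mod_orderOf]
  rw [h1]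
  simp

lemma rotateTo_galoisSequence (hθ : IsPrimitiveElement θ) (hd : 1 ≤ d) (r : ℤ) (t : ℕ)
    (j : Fin t) : (rotateTo (galoisSequence d θ) r t j : ℝ) = ((1 : ℤ) : ℝ) * galoisShift θ r j := by
  rw [rotateTo, periodicExtension_galoisSequence hθ hd, galoisShift]
  simp

/-- Reduction modulo `4n` is invisible both to the signs, of period 4, and to the powers of `θ`, of
period `n`. Only `r` modulo 4 matters for the signs, which gives a natural-number shift. -/
lemma periodicExtension_sign_mul {s : ℕ → ℤ} (hs : Function.Periodic s 4)
    (hθ : IsPrimitiveElement θ) (hd : 1 ≤ d) (j : ℕ) (r : ℤ) :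
    periodicExtension (fun i : Fin (4 * (2 ^ d - 1)) =>
      s i * periodicExtension (galoisSequence d θ) (i : ℤ)) ((j : ℤ) + r) =
    s (j + (r % 4).toNat) *
      canonicalCharacter d ((θ ^ ((j : ℤ) + r) : (GaloisField 2 d)ˣ) : GaloisField 2 d) := by
  have hn := two_pow_sub_one_pos hd
  have hN : 0 < 4 * (2 ^ d - 1) := by omega
  rw [periodicExtension, dif_pos hN]
  simp only
  have h0 : (0 : ℤ) ≤ ((j : ℤ) + r) % ((4 * (2 ^ d - 1) : ℕ) : ℤ) := Int.emod_nonneg _ (by omega)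
  congr 1
  · rw [← hs.map_mod_nat, ← hs.map_mod_nat (j + _)]
    congr 1
    have h1 : ((((j : ℤ) + r) % ((4 * (2 ^ d - 1) : ℕ) : ℤ)).toNat : ℤ) % 4 = ((j : ℤ) + r) % 4 := by
      rw [Int.toNat_of_nonneg h0]
      exact Int.emod_emod_of_dvd _ ⟨((2 ^ d - 1 : ℕ) : ℤ), by push_cast; ring⟩
    omega
  · rw [periodicExtension_galoisSequence hθ hd, Int.toNat_of_nonneg h0]
    congr 2
    rw [← zpow_mod_orderOf, ← zpow_mod_orderOf θ ((j : ℤ) + r), hθ.orderOf_eq hd]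
    congr 1
    exact Int.emod_emod_of_dvd _ ⟨4, by push_cast; ring⟩

lemma rotateTo_negaperiodic (hθ : IsPrimitiveElement θ) (hd : 1 ≤ d) (r : ℤ) (t : ℕ)
    (j : Fin t) : (rotateTo (negaperiodic (galoisSequence d θ)) r t j : ℝ) =
      negaperiodicSign (j + (r % 4).toNat) * galoisShift θ r j := by
  have := periodicExtension_sign_mul negaperiodicSign_periodic hθ hd j r
  rw [galoisShift]
  exact_mod_cast this

lemma rotateTo_periodic (hθ : IsPrimitiveElement θ) (hd : 1 ≤ d) (r : ℤ) (t : ℕ)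
    (j : Fin t) : (rotateTo (periodic (galoisSequence d θ)) r t j : ℝ) =
      periodicSign (j + (r % 4).toNat) * galoisShift θ r j := by
  have := periodicExtension_sign_mul periodicSign_periodic hθ hd j r
  rw [galoisShift]
  exact_mod_cast this

end Rotations

/-! ### Minimisation of `hInv`. -/

section LimitFunction

lemma hInv_of_le_one {T : ℝ} (hT : 0 < T) (h1 : T ≤ 1) : hInv T = 1 - 2 * T / 3 := by
  rw [hInv_eq_partialSeries (K := 1) hT (by simpa using h1)]
  simp [partialSeries]

lemma hInv_of_le_two {T : ℝ} (h1 : 1 ≤ T) (h2 : T ≤ 2) :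
    hInv T = 1 - 2 * T / 3 + 4 * (1 - 1 / T) ^ 2 := by
  have hT : 0 < T := by linarith
  have h3 : 1 / T ≤ 1 := (div_le_one hT).2 h1
  rw [hInv_eq_partialSeries (K := 2) hT (by simpa using h2)]
  simp only [partialSeries, show Ico 1 2 = {1} from rfl, sum_singleton, Nat.cast_one]
  rw [max_eq_right (by linarith)]

lemma le_hInv_of_one_le {T : ℝ} (h1 : 1 ≤ T) :
    1 - 2 * T / 3 + 4 * (1 - 1 / T) ^ 2 ≤ hInv T := by
  have hT : 0 < T := by linarith
  have h3 : 1 / T ≤ 1 := (div_le_one hT).2 h1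
  obtain ⟨K, hK⟩ := exists_nat_gt T
  have hK1 : 1 < K := by
    have : (1 : ℝ) < K := h1.trans_lt hK
    exact_mod_cast this
  rw [hInv_eq_partialSeries hT hK.le]
  have h4 : (max 0 (1 - ((1 : ℕ) : ℝ) / T)) ^ 2 ≤ partialSeries K T :=
    single_le_sum (f := fun k : ℕ => (max 0 (1 - (k : ℝ) / T)) ^ 2) (fun _ _ => sq_nonneg _)
      (mem_Ico.2 ⟨le_rfl, hK1⟩)
  rw [Nat.cast_one, max_eq_right (by linarith)] at h4
  linarith

lemma sum_sq_sub_closed_form (k : ℕ) (T : ℝ) :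
    ∑ m ∈ Ico 1 (k + 1), (T - m) ^ 2 = k * T ^ 2 - k * (k + 1) * T + k * (k + 1) * (2 * k + 1) / 6 := by
  induction k with
  | zero => simp
  | succ k ih =>
    rw [sum_Ico_succ_top (by omega), ih]
    push_cast
    ring

/-- With `k = ⌊T⌋` the series is a finite sum of squares in closed form. The bound becomes a
polynomial inequality in `k` and the fractional part `δ`; any constant above the critical value,
about 0.2992, would do. -/
lemma le_hInv_of_four_le {T : ℝ} (h4 : 4 ≤ T) : 2 / 5 ≤ hInv T := by
  have hT : 0 < T := by linarith
  set k := ⌊T⌋₊ with hk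
  have hkT : (k : ℝ) ≤ T := Nat.floor_le hT.le
  have hTk : T < k + 1 := Nat.lt_floor_add_one T
  have hk4 : (4 : ℝ) ≤ k := by
    have : 4 ≤ k := Nat.le_floor (by exact_mod_cast h4)
    exact_mod_cast this
  rw [hInv_eq_partialSeries (K := k + 1) hT (by push_cast; exact hTk.le)]
  have h1 : partialSeries (k + 1) T = (∑ m ∈ Ico 1 (k + 1), (T - m) ^ 2) / T ^ 2 := by
    rw [partialSeries, sum_div]
    refine sum_congr rfl fun m hm => ?_
    have hm' : (m : ℝ) ≤ k := by exact_mod_cast Nat.lt_succ_iff.1 (mem_Ico.1 hm).2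
    have h2 : (m : ℝ) / T ≤ 1 := (div_le_one hT).2 (hm'.trans hkT)
    rw [max_eq_right (by linarith), ← div_pow, sub_div, div_self hT.ne']
  rw [h1, sum_sq_sub_closed_form]
  obtain ⟨δ, hδ⟩ : ∃ δ, T = k + δ := ⟨T - k, by ring⟩
  have hδ0 : 0 ≤ δ := by linarith
  have hδ1 : δ ≤ 1 := by linarith
  have key : (2 * T / 3 - 3 / 5) * T ^ 2 ≤
      4 * (k * T ^ 2 - k * (k + 1) * T + k * (k + 1) * (2 * k + 1) / 6) := by
    generalize (k : ℝ) = x at *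
    subst hδ
    have hx : 0 ≤ x - 4 := by linarith
    have hx0 : 0 ≤ x := by linarith
    have hδ2 : 0 ≤ 1 - δ := by linarith
    have e1 : 0 ≤ x ^ 2 * (x - 4) := by positivity
    have e2 : 0 ≤ x * δ * (x - 4) := by positivity
    have e3 : 0 ≤ δ ^ 2 * (x - 4) := by positivity
    have e4 : 0 ≤ δ ^ 2 * (1 - δ) := by positivity
    nlinarith [mul_nonneg hδ0 hx0, sq_nonneg δ, sq_nonneg x]
  have h5 := (le_div_iff₀ (by positivity : 0 < T ^ 2)).2 key
  rw [mul_div_assoc (4 : ℝ)] at h5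
  linarith

/-- The cubic for `b` says that the derivative of the one-term expression vanishes at `b`. Cleared
of denominators, the difference is a cubic in `T` with a double root at `b`, and its constant term
forces the third root `6 / b ^ 2`. -/
lemma limit_sub_min_eq {b T : ℝ} (hb : b ^ 3 - 12 * b + 12 = 0) (hb0 : b ≠ 0) (hT : T ≠ 0) :
    1 - 2 * T / 3 + 4 * (1 - 1 / T) ^ 2 - (5 * b ^ 2 - 16 * b + 12) / b ^ 2 =
      2 / 3 * (T - b) ^ 2 * (6 / b ^ 2 - T) / T ^ 2 := by
  field_simp
  linear_combination (-4 * T ^ 2 + 2 * T * b) * hb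

lemma lt_hInv {b T : ℝ} (hb : b ^ 3 - 12 * b + 12 = 0) (h1 : 1.115749 ≤ b) (h2 : b < 1.115750)
    (hT : 0 < T) (hTb : T ≠ b) : (5 * b ^ 2 - 16 * b + 12) / b ^ 2 < hInv T := by
  have hb0 : 0 < b := by linarith
  have hc : (5 * b ^ 2 - 16 * b + 12) / b ^ 2 < 1 / 3 := by
    rw [div_lt_iff₀ (by positivity)]
    nlinarith
  rcases le_or_gt T 1 with h | h
  · rw [hInv_of_le_one hT h]
    linarith
  rcases le_or_gt T 4 with h' | h'
  · refine lt_of_lt_of_le ?_ (le_hInv_of_one_le h.le)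
    rw [← sub_pos, limit_sub_min_eq hb hb0.ne' hT.ne']
    -- The third root is about 4.82, so the one-term bound covers `T ≤ 4`, where
    -- `le_hInv_of_four_le` takes over.
    have h3 : 4 < 6 / b ^ 2 := by
      rw [lt_div_iff₀ (by positivity)]
      nlinarith
    have h4 : 0 < (T - b) ^ 2 := by
      have := sub_ne_zero.2 hTb
      positivity
    have h5 : 0 < 6 / b ^ 2 - T := by linarith
    positivity
  · linarith [le_hInv_of_four_le h'.le]

lemma hInv_critical {b : ℝ} (hb : b ^ 3 - 12 * b + 12 = 0) (h1 : 1.115749 ≤ b)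
    (h2 : b < 1.115750) : hInv b = (5 * b ^ 2 - 16 * b + 12) / b ^ 2 := by
  have hb0 : b ≠ 0 := by linarith
  rw [hInv_of_le_two (by linarith) (by linarith), ← sub_eq_zero, limit_sub_min_eq hb hb0 hb0]
  simp

lemma exists_roots : ∃ T₁ Tb T₃ : ℝ, T₁ < Tb ∧ Tb < T₃ ∧
    (∀ x : ℝ, x ^ 3 - 12 * x + 12 = 0 ↔ x = T₁ ∨ x = Tb ∨ x = T₃) ∧
    1.115749 ≤ Tb ∧ Tb < 1.115750 := by
  have hcont : Continuous fun x : ℝ => x ^ 3 - 12 * x + 12 := by fun_prop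
  obtain ⟨a, ⟨ha1, ha2⟩, ha⟩ := intermediate_value_Icc (show (-4 : ℝ) ≤ -3 by norm_num)
    hcont.continuousOn (show (0 : ℝ) ∈ _ by constructor <;> norm_num)
  obtain ⟨b, ⟨hb1, hb2⟩, hb⟩ := intermediate_value_Icc' (show (1.115749 : ℝ) ≤ 1.115750 by norm_num)
    hcont.continuousOn (show (0 : ℝ) ∈ _ by constructor <;> norm_num)
  obtain ⟨c, ⟨hc1, hc2⟩, hc⟩ := intermediate_value_Icc (show (2 : ℝ) ≤ 3 by norm_num)
    hcont.continuousOn (show (0 : ℝ) ∈ _ by constructor <;> norm_num)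
  simp only at ha hb hc
  -- The cubic has no quadratic term, so its roots sum to zero and two distinct roots determine the
  -- third.
  have third : ∀ x y z : ℝ, x ^ 3 - 12 * x + 12 = 0 → y ^ 3 - 12 * y + 12 = 0 →
      z ^ 3 - 12 * z + 12 = 0 → x ≠ y → z ≠ x → z ≠ y → z = -x - y := by
    intro x y z hx hy hz hxy hzx hzy
    have e1 : x ^ 2 + x * y + y ^ 2 = 12 :=
      mul_left_cancel₀ (sub_ne_zero.2 hxy) (by linear_combination hx - hy)
    have e2 : z ^ 2 + z * x + x ^ 2 = 12 :=
      mul_left_cancel₀ (sub_ne_zero.2 hzx) (by linear_combination hz - hx)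
    exact mul_left_cancel₀ (sub_ne_zero.2 hzy) (by linear_combination e2 - e1)
  refine ⟨a, b, c, by linarith, by linarith, fun x => ⟨fun hx => ?_, ?_⟩, hb1, ?_⟩
  · by_cases h1 : x = a
    · exact Or.inl h1
    by_cases h2 : x = b
    · exact Or.inr (Or.inl h2)
    have hab : a ≠ b := by intro h; linarith
    right; right
    rw [third a b x ha hb hx hab h1 h2, third a b c ha hb hc hab (by intro h; linarith)
      (by intro h; linarith)]
  · rintro (rfl | rfl | rfl) <;> assumption
  · refine lt_of_le_of_ne hb2 ?_
    rintro rfl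
    norm_num at hb

/-- Eliminating `b` shows that the value is a root of the second cubic. That cubic is strictly
increasing beyond 3.3, which makes this root the largest and lets the decimal bounds be read off
from signs. -/
lemma critical_value {b : ℝ} (hb : b ^ 3 - 12 * b + 12 = 0) (h1 : 1.115749 ≤ b)
    (h2 : b < 1.115750) :
    IsGreatest {x : ℝ | 7 * x ^ 3 - 33 * x ^ 2 + 33 * x - 3 = 0}
      (b ^ 2 / (5 * b ^ 2 - 16 * b + 12)) ∧
    3.342065 ≤ b ^ 2 / (5 * b ^ 2 - 16 * b + 12) ∧
    b ^ 2 / (5 * b ^ 2 - 16 * b + 12) < 3.342066 := by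
  have hD : 0 < 5 * b ^ 2 - 16 * b + 12 := by nlinarith
  set F := b ^ 2 / (5 * b ^ 2 - 16 * b + 12) with hF
  have hroot : 7 * F ^ 3 - 33 * F ^ 2 + 33 * F - 3 = 0 := by
    have hFD : F * (5 * b ^ 2 - 16 * b + 12) = b ^ 2 := div_mul_cancel₀ _ hD.ne'
    have e1 : (5 * b ^ 2 - 16 * b + 12) ^ 3 * (7 * F ^ 3 - 33 * F ^ 2 + 33 * F - 3) =
        7 * (F * (5 * b ^ 2 - 16 * b + 12)) ^ 3 -
        33 * (F * (5 * b ^ 2 - 16 * b + 12)) ^ 2 * (5 * b ^ 2 - 16 * b + 12) +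
        33 * (F * (5 * b ^ 2 - 16 * b + 12)) * (5 * b ^ 2 - 16 * b + 12) ^ 2 -
        3 * (5 * b ^ 2 - 16 * b + 12) ^ 3 := by ring
    rw [hFD] at e1
    refine (mul_eq_zero.1 (e1.trans ?_)).resolve_left (pow_ne_zero 3 hD.ne')
    -- The coefficient is the quotient of the eliminated degree-six polynomial by the cubic of `b`.
    linear_combination (-432 + 1296 * b - 1152 * b ^ 2 + 292 * b ^ 3) * hb
  have hF3 : 3.3 < F := by
    rw [hF, lt_div_iff₀ hD]
    nlinarith
  have hmono : ∀ x y : ℝ, 3.3 < x → x < y →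
      7 * x ^ 3 - 33 * x ^ 2 + 33 * x - 3 < 7 * y ^ 3 - 33 * y ^ 2 + 33 * y - 3 := by
    intro x y hx hxy
    have e : 0 < 7 * (x ^ 2 + x * y + y ^ 2) - 33 * (x + y) + 33 := by nlinarith
    nlinarith [mul_pos (sub_pos.2 hxy) e]
  refine ⟨⟨hroot, fun x hx => ?_⟩, ?_, ?_⟩
  · by_contra! h
    have := hmono F x hF3 h
    rw [hroot] at this
    exact this.ne' hx
  · by_contra! h
    have := hmono F _ hF3 h
    rw [hroot] at this
    norm_num at this
  · by_contra! h
    rcases h.eq_or_lt with h | h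
    · rw [← h] at hroot
      norm_num at hroot
    · have := hmono _ F (by norm_num) h
      rw [hroot] at this
      norm_num at this

lemma hInv_pos {T : ℝ} (hT : 0 < T) : 0 < hInv T := by
  obtain ⟨T₁, b, T₃, -, -, h, h1, h2⟩ := exists_roots
  have hb : b ^ 3 - 12 * b + 12 = 0 := (h b).2 (Or.inr (Or.inl rfl))
  have hb0 : 0 < b := by linarith
  have hD : 0 < (5 * b ^ 2 - 16 * b + 12) / b ^ 2 := by
    have : 0 < 5 * b ^ 2 - 16 * b + 12 := by nlinarith
    positivity
  by_cases hTb : T = b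
  · rw [hTb, hInv_critical hb h1 h2]
    exact hD
  · exact hD.trans (lt_hInv hb h1 h2 hT hTb)

end LimitFunction

lemma tendsto_two_pow_sub_one : Tendsto (fun d : ℕ => 2 ^ d - 1) atTop atTop := by
  refine tendsto_atTop_mono (fun d => ?_) tendsto_id
  have := Nat.lt_two_pow_self (n := d)
  simp only [id]
  omega

lemma coprime_four_two_pow_sub_one {d : ℕ} (hd : 1 ≤ d) : Nat.Coprime 4 (2 ^ d - 1) := by
  have h : Nat.Coprime 2 (2 ^ d - 1) := by
    rw [Nat.coprime_two_left, Nat.odd_sub' Nat.one_le_two_pow]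
    simp [Nat.even_pow]
    omega
  exact Nat.Coprime.pow_left 2 h

end MeritFactor

theorem mainTheorem4 :
    (∀ (θ : (d : ℕ) → (GaloisField 2 d)ˣ),
      (∀ d, 1 ≤ d → MeritFactor.IsPrimitiveElement (θ d)) →
      ∀ (r : ℕ → ℤ) (t : ℕ → ℕ) (T : ℝ), 0 < T →
        (Tendsto (fun d : ℕ => (t d : ℝ) / ((2 ^ d - 1 : ℕ) : ℝ)) atTop (𝓝 T) →
          Tendsto (fun d : ℕ => MeritFactor.meritFactor
            (MeritFactor.rotateTo (MeritFactor.galoisSequence d (θ d)) (r d) (t d)))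
            atTop (𝓝 (MeritFactor.h T))) ∧
        (Tendsto (fun d : ℕ => (t d : ℝ) / (2 * ((2 ^ d - 1 : ℕ) : ℝ))) atTop (𝓝 T) →
          Tendsto (fun d : ℕ => MeritFactor.meritFactor
            (MeritFactor.rotateTo
              (MeritFactor.negaperiodic (MeritFactor.galoisSequence d (θ d))) (r d) (t d)))
            atTop (𝓝 (MeritFactor.h T))) ∧
        (Tendsto (fun d : ℕ => (t d : ℝ) / (4 * ((2 ^ d - 1 : ℕ) : ℝ))) atTop (𝓝 T) →
          Tendsto (fun d : ℕ => MeritFactor.meritFactor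
            (MeritFactor.rotateTo
              (MeritFactor.periodic (MeritFactor.galoisSequence d (θ d))) (r d) (t d)))
            atTop (𝓝 (MeritFactor.h T)))) ∧
    (∀ T : ℝ, 0 < T → 0 < MeritFactor.hInv T) ∧
    (∃ T₁ Tb T₃ Fb : ℝ,
      T₁ < Tb ∧ Tb < T₃ ∧
      (∀ x : ℝ, x ^ 3 - 12 * x + 12 = 0 ↔ x = T₁ ∨ x = Tb ∨ x = T₃) ∧
      1.115749 ≤ Tb ∧ Tb < 1.115750 ∧
      IsGreatest {x : ℝ | 7 * x ^ 3 - 33 * x ^ 2 + 33 * x - 3 = 0} Fb ∧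
      3.342065 ≤ Fb ∧ Fb < 3.342066 ∧
      MeritFactor.h Tb = Fb ∧
      ∀ T : ℝ, 0 < T → T ≠ Tb → MeritFactor.h T < Fb) := by
  refine ⟨fun θ hθ r t T hT => ?_, fun T hT => MeritFactor.hInv_pos hT, ?_⟩
  · have hpos := (MeritFactor.hInv_pos hT).ne'
    have ha : ∀ᶠ d in atTop, MeritFactor.IsShiftAddSeq (2 ^ d - 1)
        (MeritFactor.galoisShift (θ d) (r d)) := by
      filter_upwards [eventually_ge_atTop 1] with d hd
      exact (hθ d hd).isShiftAddSeq hd (r d)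
    have h4 : ∀ᶠ d : ℕ in atTop, Nat.Coprime 4 (2 ^ d - 1) := by
      filter_upwards [eventually_ge_atTop 1] with d hd
      exact MeritFactor.coprime_four_two_pow_sub_one hd
    refine ⟨fun ht => ?_, fun ht => ?_, fun ht => ?_⟩
    · refine MeritFactor.tendsto_meritFactor one_pos hT hpos MeritFactor.tendsto_two_pow_sub_one
        (Eventually.of_forall fun d => Nat.coprime_one_left _) ha
        (fun _ => MeritFactor.isSignSeq_one) (by simpa using ht) _ ?_
      filter_upwards [eventually_ge_atTop 1] with d hd j
      exact MeritFactor.rotateTo_galoisSequence (hθ d hd) hd (r d) (t d) j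
    · refine MeritFactor.tendsto_meritFactor two_pos hT hpos MeritFactor.tendsto_two_pow_sub_one
        (h4.mono fun d hd => hd.coprime_dvd_left (by norm_num)) ha
        (fun d => MeritFactor.isSignSeq_negaperiodicSign.shift ((r d % 4).toNat))
        (by simpa using ht) _ ?_
      filter_upwards [eventually_ge_atTop 1] with d hd j
      exact MeritFactor.rotateTo_negaperiodic (hθ d hd) hd (r d) (t d) j
    · refine MeritFactor.tendsto_meritFactor four_pos hT hpos MeritFactor.tendsto_two_pow_sub_one
        h4 ha
        (fun d => MeritFactor.isSignSeq_periodicSign.shift ((r d % 4).toNat))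
        (by simpa using ht) _ ?_
      filter_upwards [eventually_ge_atTop 1] with d hd j
      exact MeritFactor.rotateTo_periodic (hθ d hd) hd (r d) (t d) j
  · obtain ⟨T₁, b, T₃, h1b, hb3, hroots, h1, h2⟩ := MeritFactor.exists_roots
    have hb : b ^ 3 - 12 * b + 12 = 0 := (hroots b).2 (Or.inr (Or.inl rfl))
    obtain ⟨hF1, hF2, hF3⟩ := MeritFactor.critical_value hb h1 h2
    have hFb : MeritFactor.h b = b ^ 2 / (5 * b ^ 2 - 16 * b + 12) := by
      rw [MeritFactor.h, MeritFactor.hInv_critical hb h1 h2, one_div_div]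
    refine ⟨T₁, b, T₃, _, h1b, hb3, hroots, h1, h2, hF1, hF2, hF3, hFb, fun T hT hTb => ?_⟩
    have hlt := MeritFactor.lt_hInv hb h1 h2 hT hTb
    rw [← MeritFactor.hInv_critical hb h1 h2] at hlt
    rw [← hFb]
    exact one_div_lt_one_div_of_lt (MeritFactor.hInv_pos (by linarith)) hlt
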